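/- Let $(\Omega, g)$ be a smooth three dimensional Riemannian manifold (possibly with boundary) and let $\Sigma\subset\Omega$ be a smoothly embedded closed surface diffeomorphic to the 2-sphere (possibly a component of $\partial\Omega$). Let $\sigma$ be the metric induced on $\Sigma$ and suppose that its Gaussian curvature is positive. Let $H$ be the mean curvature of $\Sigma$ in $\Omega$, i.e. the trace of the second fundamental form $\langle\nabla_v\nu, w\rangle$ with respect to a smooth unit normal field $\nu$ along $\Sigma$, and suppose that $H>0$ on $\Sigma$. Let $$X=(X^1,X^2,X^3):\Sigma\hookrightarrow\mathbb{R}^3$$ be a smooth isometric embedding of $(\Sigma,\sigma)$ into $\mathbb{R}^3$, and let $\mathbb{II}_0$ and $H_0=\mathrm{tr}_\sigma\,\mathbb{II}_0$ be the second fundamental form and the mean curvature of $X(\Sigma)$ with respect to the outward unit normal $N$, $\mathbb{II}_0(v,w)=\langle \partial_v N, dX(w)\rangle$ (so that a round sphere of radius $r$ has $H_0=2/r$). Given a constant $a_0$ and a constant unit vector $a=(a_1,a_2,a_3)\in\mathbb{R}^3$, let $\eta=a_0+\sum_{i=1}^3 a_iX^i$. Then $$\int_\Sigma\left[\frac{(\Delta\eta)^2}{H}+(H_0-H)|\nabla\eta|^2-\mathbb{II}_0(\nabla\eta,\nabla\eta)\right]dv_\Sigma\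 \ge\ 8\pi\,\mathfrak{m}_{BY}(\Sigma,\Omega),\qquad \mathfrak{m}_{BY}(\Sigma,\Omega)=\frac1{8\pi}\int_\Sigma(H_0-H)\,dv_\Sigma,$$ where $\nabla$, $\Delta$ and $dv_\Sigma$ are the gradient, the Laplacian and the area measure of $(\Sigma,\sigma)$. -/

import Mathlib

open Set Metric MeasureTheory
open scoped Manifold ContDiff EuclideanSpace

-- so that `ℝⁿ` carries Mathlib's charted space structure `chartedSpaceSelf` on the nose
attribute [-instance] TopCat.of.chartedSpace


noncomputable section

namespace BrownYork

/-- A smooth Riemannian metric on an `n`-dimensional manifold (possibly with boundary). -/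
abbrev RMetric {n : ℕ} {H : Type*} [TopologicalSpace H]
    (I : ModelWithCorners ℝ (EuclideanSpace ℝ (Fin n)) H)
    (M : Type*) [TopologicalSpace M] [ChartedSpace H M] [IsManifold I ∞ M] :=
  Bundle.ContMDiffRiemannianMetric I ∞ (EuclideanSpace ℝ (Fin n))
    (fun x : M => TangentSpace I x)

section Local

variable {n : ℕ} {H : Type*} [TopologicalSpace H]
  {I : ModelWithCorners ℝ (EuclideanSpace ℝ (Fin n)) H}
  {M : Type*} [TopologicalSpace M] [ChartedSpace H M] [IsManifold I ∞ M]

/-- The `i`-th standard basis vector of `ℝⁿ`. -/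
abbrev e (i : Fin n) : EuclideanSpace ℝ (Fin n) := EuclideanSpace.single i 1

/-- The metric `g` read in the preferred chart at `q`, at the coordinate point `x`, evaluated on
the coordinate vectors `u`, `v`. -/
def coordMetric (g : RMetric I M) (q : M) (x u v : EuclideanSpace ℝ (Fin n)) : ℝ :=
  g.inner ((extChartAt I q).symm x)
    (mfderivWithin 𝓘(ℝ, EuclideanSpace ℝ (Fin n)) I (extChartAt I q).symm (range I) x u)
    (mfderivWithin 𝓘(ℝ, EuclideanSpace ℝ (Fin n)) I (extChartAt I q).symm (range I) x v)

/-- The matrix `g_{ij}(x)` of the metric in the preferred chart at `q`. -/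
def coordGram (g : RMetric I M) (q : M) (x : EuclideanSpace ℝ (Fin n)) :
    Matrix (Fin n) (Fin n) ℝ :=
  Matrix.of fun i j => coordMetric g q x (e i) (e j)

/-- The derivative `∂_w (g(u, v))` of the metric coefficients in the preferred chart at `q`
(one-sided at boundary points), for constant coordinate vectors `u`, `v`. -/
def dCoordMetric (g : RMetric I M) (q : M) (x w u v : EuclideanSpace ℝ (Fin n)) : ℝ :=
  fderivWithin ℝ (fun y => coordMetric g q y u v) (range I) x w

/-- The Levi-Civita connection in the preferred chart at `q`: `christoffel g q x u v` is the
coordinate vector with components `Γ^k_{ij}(x) u^i v^j`, where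
`Γ^k_{ij} = ½ g^{kl} (∂_i g_{jl} + ∂_j g_{il} - ∂_l g_{ij})`. -/
def christoffel (g : RMetric I M) (q : M) (x u v : EuclideanSpace ℝ (Fin n)) :
    EuclideanSpace ℝ (Fin n) :=
  ∑ k, (∑ l, (coordGram g q x)⁻¹ k l *
    ((dCoordMetric g q x u v (e l) + dCoordMetric g q x v u (e l)
      - dCoordMetric g q x (e l) u v) / 2)) • e k

/-- The curvature operator `R(u, v) w = ∇_u ∇_v w - ∇_v ∇_u w` in the preferred chart at `q`, for
constant coordinate vectors `u`, `v`, `w`. -/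
def coordCurvature (g : RMetric I M) (q : M) (x u v w : EuclideanSpace ℝ (Fin n)) :
    EuclideanSpace ℝ (Fin n) :=
  fderivWithin ℝ (fun y => christoffel g q y v w) (range I) x u
    - fderivWithin ℝ (fun y => christoffel g q y u w) (range I) x v
    + christoffel g q x u (christoffel g q x v w)
    - christoffel g q x v (christoffel g q x u w)

/-- The matrix `g(e_i, e_j)` of the metric at `q`. Here `TangentSpace I q` is `ℝⁿ` by definition,
`e_i` being the `i`-th coordinate vector at `q` of the preferred chart at `q`. -/
def gram (g : RMetric I M) (q : M) : Matrix (Fin n) (Fin n) ℝ :=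
  Matrix.of fun i j => g.inner q (e i) (e j)

/-- The trace `g^{ij} B(e_i, e_j)` of a bilinear form `B` on the tangent space at `q`. -/
def traceForm (g : RMetric I M) (q : M)
    (B : TangentSpace I q → TangentSpace I q → ℝ) : ℝ :=
  ∑ i, ∑ j, (gram g q)⁻¹ i j * B (e i) (e j)

/-- The gradient `∇φ = g^{ij} (∂_j φ) e_i` of a function. -/
def grad (g : RMetric I M) (φ : M → ℝ) (q : M) : TangentSpace I q :=
  ∑ i, (∑ j, (gram g q)⁻¹ i j * mvfderiv I φ q (e j : EuclideanSpace ℝ (Fin n))) •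
    (e i : EuclideanSpace ℝ (Fin n))

/-- The Hessian `∇²φ(u, v) = ∂_u ∂_v φ - dφ(Γ(u, v))` of a function. -/
def hessian (g : RMetric I M) (φ : M → ℝ) (q : M) (u v : TangentSpace I q) : ℝ :=
  fderivWithin ℝ (fun y => fderivWithin ℝ (φ ∘ (extChartAt I q).symm) (range I) y v)
      (range I) (extChartAt I q q) u
    - mvfderiv I φ q (christoffel g q (extChartAt I q q) u v)

/-- The Laplace-Beltrami operator `Δφ = tr_g ∇²φ`. -/
def laplacian (g : RMetric I M) (φ : M → ℝ) (q : M) : ℝ :=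
  traceForm g q (hessian g φ q)

/-- The Riemannian volume measure: the least measure which dominates, for every chart domain, the
measure given there by the density `√(det g_{ij}) dx¹ ⋯ dxⁿ`. Since the densities agree on overlaps,
it restricts to that measure on each chart domain. -/
def volumeMeasure [MeasurableSpace M] (g : RMetric I M) : Measure M :=
  ⨆ q : M, (((volume : Measure (EuclideanSpace ℝ (Fin n))).restrict
      (extChartAt I q).target).withDensity
    (fun x => ENNReal.ofReal (Real.sqrt (coordGram g q x).det))).map (extChartAt I q).symm

end Local

section Surface

variable {S : Type*} [TopologicalSpace S] [ChartedSpace (EuclideanSpace ℝ (Fin 2)) S]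
  [IsManifold (𝓡 2) ∞ S]

/-- The Gaussian curvature `K = g(R(e₁, e₂) e₂, e₁) / det g` of a Riemannian surface. -/
def gaussCurvature (σ : RMetric (𝓡 2) S) (p : S) : ℝ :=
  σ.inner p (coordCurvature σ p (extChartAt (𝓡 2) p p) (e 0) (e 1) (e 1))
    (e 0 : EuclideanSpace ℝ (Fin 2)) / (gram σ p).det

section Ambient

variable {H : Type*} [TopologicalSpace H]
  {I : ModelWithCorners ℝ (EuclideanSpace ℝ (Fin 3)) H}
  {M : Type*} [TopologicalSpace M] [ChartedSpace H M] [IsManifold I ∞ M]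

/-- `f` is a smooth isometric embedding of the closed surface `(S, σ)` into `(M, g)`, i.e. a smooth
topological embedding such that `σ` is the metric induced by `g`. In particular the differential of
`f` is injective. -/
structure IsIsometricEmbedding (σ : RMetric (𝓡 2) S) (g : RMetric I M) (f : S → M) : Prop where
  contMDiff : ContMDiff (𝓡 2) I ∞ f
  isEmbedding : Topology.IsEmbedding f
  isometric : ∀ (p : S) (v w : TangentSpace (𝓡 2) p),
    g.inner (f p) (mfderiv (𝓡 2) I f p v) (mfderiv (𝓡 2) I f p w) = σ.inner p v w

/-- `ν` is a smooth unit normal field along the immersed surface `f : S → M`. -/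
structure IsUnitNormal (g : RMetric I M) (f : S → M) (ν : (p : S) → TangentSpace I (f p)) :
    Prop where
  contMDiff : ContMDiff (𝓡 2) I.tangent ∞ (fun p => (⟨f p, ν p⟩ : TangentBundle I M))
  unit : ∀ p, g.inner (f p) (ν p) (ν p) = 1
  normal : ∀ (p : S) (v : TangentSpace (𝓡 2) p), g.inner (f p) (ν p) (mfderiv (𝓡 2) I f p v) = 0

/-- The second fundamental form `II(v, w) = -g(∇_v (df w), ν) = g(∇_v ν, df w)` of the surface
`f : S → M` with respect to the unit normal field `ν`. In charts at `p` and at `f p`,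
`∇_v (df w)` has the components `∂_v ∂_w f + Γ(∂_v f, ∂_w f)` up to a tangential vector. -/
def secondForm (g : RMetric I M) (f : S → M) (ν : (p : S) → TangentSpace I (f p)) (p : S)
    (v w : TangentSpace (𝓡 2) p) : ℝ :=
  -g.inner (f p)
    (fderiv ℝ (fun y => fderiv ℝ (writtenInExtChartAt (𝓡 2) I p f) y w) (extChartAt (𝓡 2) p p) v
      + christoffel g (f p) (extChartAt I (f p) (f p))
        (mfderiv (𝓡 2) I f p v) (mfderiv (𝓡 2) I f p w) : EuclideanSpace ℝ (Fin 3))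
    (ν p)

/-- The mean curvature `H = tr_σ II` of the surface `f : (S, σ) → (M, g)` with respect to the unit
normal field `ν`. -/
def meanCurvature (σ : RMetric (𝓡 2) S) (g : RMetric I M) (f : S → M)
    (ν : (p : S) → TangentSpace I (f p)) (p : S) : ℝ :=
  traceForm σ p (secondForm g f ν p)

end Ambient

/-- `X` is a smooth isometric embedding of the closed surface `(S, σ)` into Euclidean space, i.e.
a smooth topological embedding which induces the metric `σ`. -/
structure IsEuclideanIsometricEmbedding (σ : RMetric (𝓡 2) S)
    (X : S → EuclideanSpace ℝ (Fin 3)) : Prop where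
  contMDiff : ContMDiff (𝓡 2) (𝓡 3) ∞ X
  isEmbedding : Topology.IsEmbedding X
  isometric : ∀ (p : S) (v w : TangentSpace (𝓡 2) p),
    inner ℝ (mvfderiv (𝓡 2) X p v) (mvfderiv (𝓡 2) X p w) = σ.inner p v w

/-- `N` is the smooth outward unit normal field of the closed embedded surface `X : S → ℝ³`:
from `X p` it points into the unbounded component of the complement of the surface. -/
structure IsOutwardUnitNormal (X N : S → EuclideanSpace ℝ (Fin 3)) : Prop where
  contMDiff : ContMDiff (𝓡 2) (𝓡 3) ∞ N
  unit : ∀ p, ‖N p‖ = 1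
  normal : ∀ (p : S) (v : TangentSpace (𝓡 2) p), inner ℝ (N p) (mvfderiv (𝓡 2) X p v) = 0
  outward : ∀ p, ∃ ε > 0, ∀ t ∈ Ioo (0 : ℝ) ε,
    ¬ Bornology.IsBounded (connectedComponentIn (range X)ᶜ (X p + t • N p))

/-- The second fundamental form `II₀(v, w) = -⟨∂_v ∂_w X, N⟩ = ⟨∂_v N, ∂_w X⟩` of the surface
`X : S → ℝ³` with respect to the unit normal field `N`. -/
def euclideanSecondForm (X N : S → EuclideanSpace ℝ (Fin 3)) (p : S)
    (v w : TangentSpace (𝓡 2) p) : ℝ :=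
  -inner ℝ
    (fderiv ℝ (fun y => fderiv ℝ (X ∘ (extChartAt (𝓡 2) p).symm) y w) (extChartAt (𝓡 2) p p) v)
    (N p)

/-- The mean curvature `H₀ = tr_σ II₀` of the surface `X : (S, σ) → ℝ³` with respect to the unit
normal field `N` (a sphere of radius `r` has `H₀ = 2 / r` for the outward normal). -/
def euclideanMeanCurvature (σ : RMetric (𝓡 2) S) (X N : S → EuclideanSpace ℝ (Fin 3)) (p : S) : ℝ :=
  traceForm σ p (euclideanSecondForm X N p)

/-- The Brown-York mass `(8π)⁻¹ ∫ (H₀ - H) dv` of a surface `(S, σ)` with mean curvature `H` in the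
ambient manifold and mean curvature `H₀` in Euclidean space. -/
def brownYorkMass [MeasurableSpace S] (σ : RMetric (𝓡 2) S) (H₀ H : S → ℝ) : ℝ :=
  1 / (8 * Real.pi) * ∫ p, (H₀ p - H p) ∂(volumeMeasure σ)

end Surface

end BrownYork

end

/-! Write `w = ⟨N, a⟩`. Three pointwise identities for the restriction `η` of an affine function to
a surface in `ℝ³` reduce the inequality to completing a square. Gauss' formula gives `∇²η = -w II₀`,
hence `Δη = -w H₀` (`hessian_linear`, `laplacian_linear`). The image of `∇η` under `dX` is the
tangential part `a - w N`, so `|∇η|² = 1 - w²` (`inner_grad_linear`). Since `dN` is tangential,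
Weingarten's equation gives `II₀(∇η, ∇η) = ⟨dN(∇η), a⟩ = dw(∇η)` (`secondForm_grad_linear`).

Integrating by parts, `∫ dw(∇η) = -∫ w Δη = ∫ w² H₀` (`integral_trace_linear`). Up to a term of
integral zero, the integrand is therefore `w² H₀² / H + (H₀ - H)(1 - w²) - w² H₀ = (H₀ - H) + w² (H₀
- H)² / H`, and the last summand is nonnegative because `H > 0`.

Most of the work lies in two analytic facts. The first is integrability, for which `H` has to be
continuous. Its value at a point is computed in the preferred charts at that point, and these change
with the point; so the second fundamental form is shown to have the same expression in every pair of
charts (`secondForm_inCharts`), and then the charts are kept fixed (`continuous_meanCurvature`). The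
key is the transformation law of the Christoffel symbols, `koszul_transition`.

The second is the divergence theorem for the volume measure, a supremum of chart measures. These
agree on overlaps by change of variables (`volumeMeasure_restrict_source`). A partition of unity
reduces the claim to one chart, where `√det g` times the integrand is a Euclidean divergence. It is
computed with the conormals of the coordinate frame of `X`, vectors of `ℝ³` whose divergence is the
mean curvature vector times the area density (`inner_div_conormal`). -/

namespace BrownYork

/-! ### The metric in charts and its change under transition maps. -/

section Charts

variable {n : ℕ} {H : Type*} [TopologicalSpace H]
  {I : ModelWithCorners ℝ (EuclideanSpace ℝ (Fin n)) H}
  {M : Type*} [TopologicalSpace M] [ChartedSpace H M] [IsManifold I ∞ M]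

theorem isManifold_one_of_smooth : IsManifold I 1 M :=
  IsManifold.of_le (n := ∞) (by norm_num)

theorem coordMetric_add_left (g : RMetric I M) (q : M) (x u u' v : EuclideanSpace ℝ (Fin n)) :
    coordMetric g q x (u + u') v = coordMetric g q x u v + coordMetric g q x u' v :=
  (congrArg (fun w => g.inner _ w _) (map_add (mfderivWithin 𝓘(ℝ, EuclideanSpace ℝ (Fin n)) I
    (extChartAt I q).symm (range I) x) u u')).trans
    (DFunLike.congr_fun (map_add (g.inner ((extChartAt I q).symm x)) _ _) _)

theorem coordMetric_smul_left (g : RMetric I M) (q : M) (x : EuclideanSpace ℝ (Fin n)) (c : ℝ)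
    (u v : EuclideanSpace ℝ (Fin n)) :
    coordMetric g q x (c • u) v = c * coordMetric g q x u v :=
  (congrArg (fun w => g.inner _ w _) (map_smul (mfderivWithin 𝓘(ℝ, EuclideanSpace ℝ (Fin n)) I
    (extChartAt I q).symm (range I) x) c u)).trans
    (DFunLike.congr_fun (map_smul (g.inner ((extChartAt I q).symm x)) _ _) _)

theorem coordMetric_symm (g : RMetric I M) (q : M) (x u v : EuclideanSpace ℝ (Fin n)) :
    coordMetric g q x u v = coordMetric g q x v u := g.symm _ _ _

theorem coordMetric_add_right (g : RMetric I M) (q : M) (x u v v' : EuclideanSpace ℝ (Fin n)) :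
    coordMetric g q x u (v + v') = coordMetric g q x u v + coordMetric g q x u v' := by
  simp only [coordMetric_symm g q x u, coordMetric_add_left]

theorem coordMetric_smul_right (g : RMetric I M) (q : M) (x : EuclideanSpace ℝ (Fin n)) (c : ℝ)
    (u v : EuclideanSpace ℝ (Fin n)) :
    coordMetric g q x u (c • v) = c * coordMetric g q x u v := by
  simp only [coordMetric_symm g q x u, coordMetric_smul_left]

/-- The metric in the preferred chart at `q`, as a field of continuous bilinear forms. -/
noncomputable def coordForm (g : RMetric I M) (q : M) (x : EuclideanSpace ℝ (Fin n)) :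
    EuclideanSpace ℝ (Fin n) →L[ℝ] EuclideanSpace ℝ (Fin n) →L[ℝ] ℝ :=
  LinearMap.toContinuousLinearMap
    { toFun := fun u => LinearMap.toContinuousLinearMap
        { toFun := fun v => coordMetric g q x u v
          map_add' := coordMetric_add_right g q x u
          map_smul' := fun c v => coordMetric_smul_right g q x c u v }
      map_add' := fun u w => by ext v; exact coordMetric_add_left g q x u w v
      map_smul' := fun c u => by ext v; exact coordMetric_smul_left g q x c u v }

theorem coordForm_apply (g : RMetric I M) (q : M) (x u v : EuclideanSpace ℝ (Fin n)) :
    coordForm g q x u v = coordMetric g q x u v := rfl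

/-- A coordinate field is the image of a constant section under the tangent map of the inverse
chart, so it inherits the smoothness of that map. -/
theorem contMDiffOn_frame (q : M) (u : EuclideanSpace ℝ (Fin n)) :
    ContMDiffOn 𝓘(ℝ, EuclideanSpace ℝ (Fin n)) I.tangent ∞
      (fun x => (⟨(extChartAt I q).symm x,
        mfderivWithin 𝓘(ℝ, EuclideanSpace ℝ (Fin n)) I (extChartAt I q).symm (range I) x u⟩ :
        TangentBundle I M)) (extChartAt I q).target := by
  have h := (contMDiffOn_extChartAt_symm (I := I) (n := ∞) q)
  have h2 := h.contMDiffOn_tangentMapWithin (m := ∞) (by simp)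
    (uniqueDiffOn_extChartAt_target (I := I) q).uniqueMDiffOn
  have h3 : ContMDiff 𝓘(ℝ, EuclideanSpace ℝ (Fin n)) 𝓘(ℝ, EuclideanSpace ℝ (Fin n)).tangent ∞
      (fun x => (⟨x, u⟩ : TangentBundle 𝓘(ℝ, EuclideanSpace ℝ (Fin n))
        (EuclideanSpace ℝ (Fin n)))) := by
    intro x
    rw [Bundle.contMDiffAt_totalSpace]
    refine ⟨contMDiffAt_id, ?_⟩
    simpa using contMDiffAt_const
  have h4 := h2.comp (h3.contMDiffOn (s := (extChartAt I q).target)) (fun x hx => hx)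
  refine h4.congr fun x hx => ?_
  simp only [Function.comp, tangentMapWithin]
  -- Near a point of the target, the target and `range I` are the same set, also at boundary points;
  -- so the two one-sided derivatives agree.
  rw [mfderivWithin_congr_set (extChartAt_target_eventuallyEq_of_mem hx)]

theorem contDiffOn_coordMetric (g : RMetric I M) (q : M) (u v : EuclideanSpace ℝ (Fin n)) :
    ContDiffOn ℝ ∞ (fun x => coordMetric g q x u v) (extChartAt I q).target := by
  rw [← contMDiffOn_iff_contDiffOn]
  have := (g.contMDiff.comp_contMDiffOn (contMDiffOn_extChartAt_symm q)).clm_bundle_apply₂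
    (F₁ := EuclideanSpace ℝ (Fin n)) (F₂ := EuclideanSpace ℝ (Fin n))
    (E₃ := Bundle.Trivial M ℝ) (F₃ := ℝ)
    (contMDiffOn_frame (I := I) q u) (contMDiffOn_frame (I := I) q v)
  intro x hx
  have h2 := this x hx
  rw [Bundle.contMDiffWithinAt_totalSpace] at h2
  exact h2.2

theorem contDiffOn_coordForm (g : RMetric I M) (q : M) :
    ContDiffOn ℝ ∞ (coordForm g q) (extChartAt I q).target := by
  rw [contDiffOn_clm_apply]
  intro u
  rw [contDiffOn_clm_apply]
  intro v
  exact contDiffOn_coordMetric g q u v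

theorem coordMetric_mfderiv_extChartAt (g : RMetric I M) {p q : M}
    (hp : p ∈ (extChartAt I q).source) (u v : TangentSpace I p) :
    coordMetric g q (extChartAt I q p) (mfderiv I 𝓘(ℝ, EuclideanSpace ℝ (Fin n))
      (extChartAt I q) p u) (mfderiv I 𝓘(ℝ, EuclideanSpace ℝ (Fin n)) (extChartAt I q) p v) =
    g.inner p u v := by
  have := isManifold_one_of_smooth (I := I) (M := M)
  obtain ⟨x, hx, rfl⟩ : ∃ x ∈ (extChartAt I q).target, (extChartAt I q).symm x = p :=
    ⟨_, (extChartAt I q).map_source hp, (extChartAt I q).left_inv hp⟩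
  have h1 := mfderivWithin_extChartAt_symm_comp_mfderiv_extChartAt (I := I) hx
  have h2 := fun z => DFunLike.congr_fun h1 z
  have key : ∀ y, y = x → ∀ a b : EuclideanSpace ℝ (Fin n), coordMetric g q y a b =
    coordMetric g q x a b := by rintro y rfl a b; rfl
  refine (key _ ((extChartAt I q).right_inv hx) _ _).trans ?_
  unfold coordMetric
  exact congrArg₂ (fun a b => g.inner _ a b) (h2 u) (h2 v)

/-- The preferred chart at `p` has identity differential at `p`. This is why raw vectors of `ℝⁿ` can
serve as tangent vectors in `gram` and in the second fundamental form. -/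
theorem coordMetric_extChartAt_self (g : RMetric I M) (p : M) (u v : TangentSpace I p) :
    coordMetric g p (extChartAt I p p) u v = g.inner p u v := by
  have := isManifold_one_of_smooth (I := I) (M := M)
  have := coordMetric_mfderiv_extChartAt g (mem_extChartAt_source (I := I) p) u v
  rw [mfderiv_extChartAt_self] at this
  exact this

/-- The chain rule for the differentials of the charts. -/
theorem mfderiv_extChartAt_frame {q q' : M} {x : EuclideanSpace ℝ (Fin n)}
    (hx : x ∈ (extChartAt I q).target) (hx' : (extChartAt I q).symm x ∈ (extChartAt I q').source)
    (u : EuclideanSpace ℝ (Fin n)) :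
    mfderiv I 𝓘(ℝ, EuclideanSpace ℝ (Fin n)) (extChartAt I q') ((extChartAt I q).symm x)
      (mfderivWithin 𝓘(ℝ, EuclideanSpace ℝ (Fin n)) I (extChartAt I q).symm (range I) x u) =
    fderivWithin ℝ (extChartAt I q' ∘ (extChartAt I q).symm) (range I) x u := by
  have := isManifold_one_of_smooth (I := I) (M := M)
  have h := mfderiv_comp_mfderivWithin (I := 𝓘(ℝ, EuclideanSpace ℝ (Fin n))) (I' := I)
    (I'' := 𝓘(ℝ, EuclideanSpace ℝ (Fin n)))
    x (mdifferentiableAt_extChartAt (by simpa using hx'))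
    (mdifferentiableWithinAt_extChartAt_symm hx)
    (I.uniqueMDiffOn _ (extChartAt_target_subset_range q hx))
  rw [← mfderivWithin_eq_fderivWithin, h]
  rfl

theorem coordMetric_transition (g : RMetric I M) {q q' : M} {x : EuclideanSpace ℝ (Fin n)}
    (hx : x ∈ (extChartAt I q).target) (hx' : (extChartAt I q).symm x ∈ (extChartAt I q').source)
    (u v : EuclideanSpace ℝ (Fin n)) :
    coordMetric g q x u v =
      coordMetric g q' ((extChartAt I q' ∘ (extChartAt I q).symm) x)
        (fderivWithin ℝ (extChartAt I q' ∘ (extChartAt I q).symm) (range I) x u)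
        (fderivWithin ℝ (extChartAt I q' ∘ (extChartAt I q).symm) (range I) x v) := by
  rw [← mfderiv_extChartAt_frame hx hx', ← mfderiv_extChartAt_frame hx hx']
  exact (coordMetric_mfderiv_extChartAt g hx' _ _).symm

end Charts

end BrownYork

/-! ### Second-order chain rules with one-sided derivatives. -/

section SecondDerivative

variable {P E F : Type*} [NormedAddCommGroup P] [NormedSpace ℝ P] [NormedAddCommGroup E]
  [NormedSpace ℝ E] [NormedAddCommGroup F] [NormedSpace ℝ F]

/-- The set `s` will be the range of a model with corners and need not be a neighbourhood of `f x`.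
Because `f` takes all its values in `s`, the derivative of `φ` within `s` suffices for an ordinary
derivative of the composite. -/
theorem fderiv_comp_fderivWithin_eventually {φ : E → F} {s : Set E} {f : P → E} {x : P}
    (hf : ContDiffAt ℝ 2 f x) (hfs : ∀ y, f y ∈ s) (hφ : ContDiffWithinAt ℝ 2 φ s (f x)) :
    ∀ᶠ y in nhds x, fderiv ℝ (φ ∘ f) y = (fderivWithin ℝ φ s (f y)).comp (fderiv ℝ f y) := by
  have h1 : ∀ᶠ y in nhds x, ContDiffAt ℝ 2 f y := hf.eventually (by simp)
  have h2 : ∀ᶠ z in nhdsWithin (f x) s, ContDiffWithinAt ℝ 2 φ s z := by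
    have := hφ.eventually (by simp)
    rwa [Set.insert_eq_of_mem (hfs x)] at this
  have h3 : Filter.Tendsto f (nhds x) (nhdsWithin (f x) s) :=
    tendsto_nhdsWithin_iff.2 ⟨hf.continuousAt, Filter.Eventually.of_forall hfs⟩
  filter_upwards [h1, h3.eventually h2] with y hy1 hy2
  have h4 := (hy2.differentiableWithinAt (by norm_num)).hasFDerivWithinAt
  have h5 := (hy1.differentiableAt (by norm_num)).hasFDerivAt
  exact (h4.comp_hasFDerivAt y h5 (Filter.Eventually.of_forall hfs)).fderiv

theorem fderiv_fderiv_apply {f : P → E} {x : P} (hf : ContDiffAt ℝ 2 f x) (v w : P) :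
    fderiv ℝ (fun y => fderiv ℝ f y w) x v = fderiv ℝ (fderiv ℝ f) x v w := by
  have h : DifferentiableAt ℝ (fderiv ℝ f) x :=
    (hf.fderiv_right (m := 1) (by norm_num)).differentiableAt (by norm_num)
  rw [fderiv_clm_apply h (differentiableAt_const w)]
  simp

/-- The term containing `D²φ` is the failure of the second derivative to be tensorial; the
inhomogeneous term in `koszul_transition` compensates for it. -/
theorem fderiv_fderiv_comp {φ : E → F} {s : Set E} {f : P → E} {x : P}
    (hs : UniqueDiffOn ℝ s) (hf : ContDiffAt ℝ 2 f x) (hfs : ∀ y, f y ∈ s)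
    (hφ : ContDiffWithinAt ℝ 2 φ s (f x)) (v w : P) :
    fderiv ℝ (fun y => fderiv ℝ (φ ∘ f) y w) x v =
      fderivWithin ℝ (fderivWithin ℝ φ s) s (f x) (fderiv ℝ f x v) (fderiv ℝ f x w)
        + fderivWithin ℝ φ s (f x) (fderiv ℝ (fun y => fderiv ℝ f y w) x v) := by
  have h1 : (fun y => fderiv ℝ (φ ∘ f) y w) =ᶠ[nhds x]
      fun y => fderivWithin ℝ φ s (f y) (fderiv ℝ f y w) :=
    (fderiv_comp_fderivWithin_eventually hf hfs hφ).mono fun y hy => by simp only [hy]; rfl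
  rw [h1.fderiv_eq]
  have h2 : HasFDerivWithinAt (fderivWithin ℝ φ s) (fderivWithin ℝ (fderivWithin ℝ φ s) s (f x))
      s (f x) :=
    ((hφ.fderivWithin_right (m := 1) hs (by norm_num) (hfs x)).differentiableWithinAt
      (by norm_num)).hasFDerivWithinAt
  have h3 := (hf.differentiableAt (by norm_num)).hasFDerivAt
  have h4 : DifferentiableAt ℝ (fun y => fderiv ℝ f y w) x :=
    ((hf.fderiv_right (m := 1) (by norm_num)).differentiableAt (by norm_num)).clm_apply
      (differentiableAt_const w)
  have h5 := (h2.comp_hasFDerivAt x h3 (Filter.Eventually.of_forall hfs)).clm_apply h4.hasFDerivAt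
  have h6 := h5.fderiv
  simp only [Function.comp_def] at h6
  rw [h6]
  simp [add_comm]

/-- The derivative of a pulled back field of bilinear forms. -/
theorem fderivWithin_pullback_form {G G' : E → E →L[ℝ] E →L[ℝ] ℝ} {φ : E → E} {s : Set E} {x : E}
    (hs : UniqueDiffOn ℝ s) (hx : x ∈ s) (hφs : ∀ y, φ y ∈ s) (hφ : ContDiffWithinAt ℝ 2 φ s x)
    (hG : DifferentiableWithinAt ℝ G s (φ x))
    (hG' : ∀ᶠ y in nhdsWithin x s, ∀ u v,
      G' y u v = G (φ y) (fderivWithin ℝ φ s y u) (fderivWithin ℝ φ s y v)) (u v w : E) :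
    fderivWithin ℝ (fun y => G' y u v) s x w =
      fderivWithin ℝ G s (φ x) (fderivWithin ℝ φ s x w) (fderivWithin ℝ φ s x u)
          (fderivWithin ℝ φ s x v)
        + G (φ x) (fderivWithin ℝ (fderivWithin ℝ φ s) s x w u) (fderivWithin ℝ φ s x v)
        + G (φ x) (fderivWithin ℝ φ s x u) (fderivWithin ℝ (fderivWithin ℝ φ s) s x w v) := by
  have h1 : (fun y => G' y u v) =ᶠ[nhdsWithin x s]
      fun y => G (φ y) (fderivWithin ℝ φ s y u) (fderivWithin ℝ φ s y v) :=
    hG'.mono fun y hy => hy u v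
  rw [h1.fderivWithin_eq_of_mem hx]
  have h2 : HasFDerivWithinAt (fderivWithin ℝ φ s) (fderivWithin ℝ (fderivWithin ℝ φ s) s x) s x :=
    ((hφ.fderivWithin_right (m := 1) hs (by norm_num) hx).differentiableWithinAt
      (by norm_num)).hasFDerivWithinAt
  have h3 := (hφ.differentiableWithinAt (by norm_num)).hasFDerivWithinAt
  have h4 : HasFDerivWithinAt (fun y => G (φ y))
      ((fderivWithin ℝ G s (φ x)).comp (fderivWithin ℝ φ s x)) s x :=
    HasFDerivWithinAt.comp (g := G) (f := φ) (t := s) x hG.hasFDerivWithinAt h3 fun y _ => hφs y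
  have h5 := fun z => h2.clm_apply (hasFDerivWithinAt_const z x s)
  have h6 := (h4.clm_apply (h5 u)).clm_apply (h5 v)
  rw [h6.fderivWithin (hs x hx)]
  simp
  ring

end SecondDerivative

namespace BrownYork

/-! ### Christoffel symbols of the first kind and their transformation law. -/

section Koszul

variable {n : ℕ} {H : Type*} [TopologicalSpace H]
  {I : ModelWithCorners ℝ (EuclideanSpace ℝ (Fin n)) H}
  {M : Type*} [TopologicalSpace M] [ChartedSpace H M] [IsManifold I ∞ M]

theorem coordMetric_self_pos (g : RMetric I M) {q : M} {x : EuclideanSpace ℝ (Fin n)}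
    (hx : x ∈ (extChartAt I q).target) {u : EuclideanSpace ℝ (Fin n)} (hu : u ≠ 0) :
    0 < coordMetric g q x u u := by
  have := isManifold_one_of_smooth (I := I) (M := M)
  have hinj := (isInvertible_mfderivWithin_extChartAt_symm (I := I) hx).injective
  refine g.pos _ _ fun h => hu (hinj ?_)
  rw [h]
  exact (map_zero _).symm

theorem coordMetric_eq_sum (g : RMetric I M) (q : M) (x u v : EuclideanSpace ℝ (Fin n)) :
    coordMetric g q x u v = ∑ i, ∑ j, u i * v j * coordGram g q x i j := by
  conv_lhs => rw [← coordForm_apply, ← (EuclideanSpace.basisFun (Fin n) ℝ).sum_repr u,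
    ← (EuclideanSpace.basisFun (Fin n) ℝ).sum_repr v]
  simp only [map_sum, map_smul, sum_apply, smul_apply,
    smul_eq_mul, EuclideanSpace.basisFun_repr, EuclideanSpace.basisFun_apply, Finset.mul_sum]
  rw [Finset.sum_comm]
  refine Finset.sum_congr rfl fun i _ => Finset.sum_congr rfl fun j _ => ?_
  simp only [coordGram, Matrix.of_apply, coordForm_apply]
  ring

theorem coordGram_posDef (g : RMetric I M) {q : M} {x : EuclideanSpace ℝ (Fin n)}
    (hx : x ∈ (extChartAt I q).target) : (coordGram g q x).PosDef := by
  refine Matrix.PosDef.of_dotProduct_mulVec_pos ?_ fun c hc => ?_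
  · ext i j
    exact coordMetric_symm g q x (e j) (e i)
  · have h := coordMetric_self_pos g hx (u := WithLp.toLp 2 c)
      (by simpa using hc)
    rw [coordMetric_eq_sum] at h
    refine h.trans_eq ?_
    simp only [dotProduct, Matrix.mulVec, Finset.mul_sum, star_trivial]
    exact Finset.sum_congr rfl fun i _ => Finset.sum_congr rfl fun j _ => by ring

theorem coordGram_mul_inv (g : RMetric I M) {q : M} {x : EuclideanSpace ℝ (Fin n)}
    (hx : x ∈ (extChartAt I q).target) : coordGram g q x * (coordGram g q x)⁻¹ = 1 :=
  Matrix.mul_nonsing_inv _ (coordGram_posDef g hx).det_pos.ne'.isUnit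

theorem gram_eq_coordGram (g : RMetric I M) (p : M) :
    gram g p = coordGram g p (extChartAt I p p) := by
  ext i j
  exact (coordMetric_extChartAt_self g p _ _).symm

theorem differentiableWithinAt_coordForm (g : RMetric I M) {q : M} {x : EuclideanSpace ℝ (Fin n)}
    (hx : x ∈ (extChartAt I q).target) :
    DifferentiableWithinAt ℝ (coordForm g q) (range I) x :=
  (((contDiffOn_coordForm g q).differentiableOn (by norm_num)) x hx).mono_of_mem_nhdsWithin
    (extChartAt_target_mem_nhdsWithin_of_mem hx)

theorem dCoordMetric_eq (g : RMetric I M) {q : M} {x : EuclideanSpace ℝ (Fin n)}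
    (hx : x ∈ (extChartAt I q).target) (w u v : EuclideanSpace ℝ (Fin n)) :
    dCoordMetric g q x w u v = fderivWithin ℝ (coordForm g q) (range I) x w u v := by
  have h1 := (differentiableWithinAt_coordForm g hx).hasFDerivWithinAt
  have h2 := fun z : EuclideanSpace ℝ (Fin n) =>
    hasFDerivWithinAt_const (𝕜 := ℝ) (s := range I) z x
  have h3 := ((h1.clm_apply (h2 u)).clm_apply (h2 v)).fderivWithin
    (I.uniqueDiffOn _ (extChartAt_target_subset_range q hx))
  unfold dCoordMetric
  simp only [coordForm_apply] at h3
  rw [h3]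
  simp

/-- The Christoffel symbols of the first kind, by Koszul's formula. -/
noncomputable def koszul (g : RMetric I M) (q : M) (x u v w : EuclideanSpace ℝ (Fin n)) : ℝ :=
  (dCoordMetric g q x u v w + dCoordMetric g q x v u w - dCoordMetric g q x w u v) / 2

theorem koszul_eq_sum (g : RMetric I M) {q : M} {x : EuclideanSpace ℝ (Fin n)}
    (hx : x ∈ (extChartAt I q).target) (u v w : EuclideanSpace ℝ (Fin n)) :
    koszul g q x u v w = ∑ j, w j * koszul g q x u v (e j) := by
  simp only [koszul, dCoordMetric_eq g hx]
  conv_lhs => rw [← (EuclideanSpace.basisFun (Fin n) ℝ).sum_repr w]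
  simp only [map_sum, map_smul, sum_apply, smul_apply,
    smul_eq_mul, EuclideanSpace.basisFun_repr, EuclideanSpace.basisFun_apply]
  rw [← Finset.sum_add_distrib, ← Finset.sum_sub_distrib, Finset.sum_div]
  exact Finset.sum_congr rfl fun i _ => by ring

/-- Lowering the index cancels the inverse Gram matrix. Everything below can then work with first
derivatives of the metric alone. -/
theorem coordMetric_christoffel (g : RMetric I M) {q : M} {x : EuclideanSpace ℝ (Fin n)}
    (hx : x ∈ (extChartAt I q).target) (u v w : EuclideanSpace ℝ (Fin n)) :
    coordMetric g q x (christoffel g q x u v) w = koszul g q x u v w := by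
  rw [koszul_eq_sum g hx, coordMetric_symm, coordMetric_eq_sum]
  refine Finset.sum_congr rfl fun j _ => ?_
  have hc : ∀ k, (christoffel g q x u v) k =
      ∑ l, (coordGram g q x)⁻¹ k l * koszul g q x u v (e l) := by
    intro k
    simp [christoffel, koszul, Pi.single_apply]
  simp only [hc, mul_assoc, ← Finset.mul_sum]
  congr 1
  have h1 := coordGram_mul_inv g hx
  have h2 : ∀ l, ∑ k, coordGram g q x j k * (coordGram g q x)⁻¹ k l = if j = l then 1 else 0 := by
    intro l
    rw [← Matrix.mul_apply, h1, Matrix.one_apply]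
  calc ∑ k, (∑ l, (coordGram g q x)⁻¹ k l * koszul g q x u v (e l)) * coordGram g q x j k
      = ∑ l, (∑ k, coordGram g q x j k * (coordGram g q x)⁻¹ k l) * koszul g q x u v (e l) := by
        simp only [Finset.sum_mul]
        rw [Finset.sum_comm]
        exact Finset.sum_congr rfl fun i _ => Finset.sum_congr rfl fun j _ => by ring
    _ = koszul g q x u v (e j) := by simp [h2]

theorem contDiffWithinAt_transition {q q' : M} {x : EuclideanSpace ℝ (Fin n)}
    (hx : x ∈ (extChartAt I q).target) (hx' : (extChartAt I q).symm x ∈ (extChartAt I q').source) :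
    ContDiffWithinAt ℝ 2 (extChartAt I q' ∘ (extChartAt I q).symm) (range I) x := by
  have := contDiffWithinAt_ext_coord_change (I := I) (n := ∞) q' q (y := x)
    (by simp only [PartialEquiv.trans_source, PartialEquiv.symm_source]; exact ⟨hx, hx'⟩)
  exact this.of_le (by norm_cast)

omit [IsManifold I ∞ M] in
theorem transition_mem_range (q q' : M) (x : EuclideanSpace ℝ (Fin n)) :
    (extChartAt I q' ∘ (extChartAt I q).symm) x ∈ range I := by
  simp

/-- Differentiating the pulled back metric produces six terms with `D²φ`. By symmetry of `D²φ` and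
of the metric, two of them coincide and make up the inhomogeneous term, and the other four cancel in
pairs. -/
theorem koszul_transition (g : RMetric I M) {q q' : M} {x : EuclideanSpace ℝ (Fin n)}
    (hx : x ∈ (extChartAt I q).target) (hx' : (extChartAt I q).symm x ∈ (extChartAt I q').source)
    {φ : EuclideanSpace ℝ (Fin n) → EuclideanSpace ℝ (Fin n)}
    (hφ : φ = extChartAt I q' ∘ (extChartAt I q).symm) (u v w : EuclideanSpace ℝ (Fin n)) :
    koszul g q x u v w = koszul g q' (φ x) (fderivWithin ℝ φ (range I) x u)
        (fderivWithin ℝ φ (range I) x v) (fderivWithin ℝ φ (range I) x w)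
      + coordMetric g q' (φ x) (fderivWithin ℝ (fderivWithin ℝ φ (range I)) (range I) x u v)
        (fderivWithin ℝ φ (range I) x w) := by
  have hxr := extChartAt_target_subset_range q hx
  have hφ2 : ContDiffWithinAt ℝ 2 φ (range I) x := hφ ▸ contDiffWithinAt_transition hx hx'
  have hφx : φ x ∈ (extChartAt I q').target := hφ ▸ (extChartAt I q').map_source hx'
  -- At a boundary point, symmetry of the one-sided second derivative needs the point to be a limit
  -- of interior points of `range I`.
  have hsymm := hφ2.isSymmSndFDerivWithinAt (by simp) I.uniqueDiffOn
    (I.range_subset_closure_interior hxr) hxr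
  have hev : ∀ᶠ y in nhdsWithin x (range I), ∀ u v, coordForm g q y u v =
      coordForm g q' (φ y) (fderivWithin ℝ φ (range I) y u) (fderivWithin ℝ φ (range I) y v) := by
    have h1 := extChartAt_target_mem_nhdsWithin_of_mem (I := I) hx
    have h2 : ∀ᶠ y in nhdsWithin x (range I),
        (extChartAt I q).symm y ∈ (extChartAt I q').source :=
      ((continuousAt_extChartAt_symm'' hx).continuousWithinAt).eventually
        ((isOpen_extChartAt_source q').mem_nhds hx')
    filter_upwards [h1, h2] with y hy1 hy2 u v
    subst hφ
    exact coordMetric_transition g hy1 hy2 u v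
  have key := fderivWithin_pullback_form I.uniqueDiffOn hxr
    (fun y => by rw [hφ]; exact transition_mem_range q q' y) hφ2
    (differentiableWithinAt_coordForm g hφx) hev
  simp only [coordForm_apply] at key
  simp only [koszul, dCoordMetric_eq g hφx]
  unfold dCoordMetric
  rw [key, key, key, hsymm.eq v u, hsymm.eq w u, hsymm.eq w v,
    coordMetric_symm g q' (φ x) (fderivWithin ℝ φ (range I) x v),
    coordMetric_symm g q' (φ x) (fderivWithin ℝ φ (range I) x u)]
  ring

end Koszul

end BrownYork

namespace BrownYork

/-! ### The normal acceleration of a map and its independence of charts. -/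

section SecondForm

variable {H : Type*} [TopologicalSpace H]
  {I : ModelWithCorners ℝ (EuclideanSpace ℝ (Fin 3)) H}
  {M : Type*} [TopologicalSpace M] [ChartedSpace H M] [IsManifold I ∞ M]
  {S : Type*} [TopologicalSpace S] [ChartedSpace (EuclideanSpace ℝ (Fin 2)) S]

/-- The component along `n` of the covariant derivative `∇_v (dF w)`, for a map `F` into the
preferred chart at `q`. -/
noncomputable def accelForm (g : RMetric I M) (q : M)
    (F : EuclideanSpace ℝ (Fin 2) → EuclideanSpace ℝ (Fin 3)) (x v w : EuclideanSpace ℝ (Fin 2))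
    (n : EuclideanSpace ℝ (Fin 3)) : ℝ :=
  coordMetric g q (F x) (fderiv ℝ (fun y => fderiv ℝ F y w) x v) n
    + koszul g q (F x) (fderiv ℝ F x v) (fderiv ℝ F x w) n

/-- Invariance of `accelForm` under a change of the chart of the target. -/
theorem accelForm_transition (g : RMetric I M) {q q' : M}
    {F : EuclideanSpace ℝ (Fin 2) → EuclideanSpace ℝ (Fin 3)} {x : EuclideanSpace ℝ (Fin 2)}
    (hF : ContDiffAt ℝ 2 F x) (hFr : ∀ y, F y ∈ range I) (hx : F x ∈ (extChartAt I q).target)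
    (hx' : (extChartAt I q).symm (F x) ∈ (extChartAt I q').source)
    (v w : EuclideanSpace ℝ (Fin 2)) (n : EuclideanSpace ℝ (Fin 3)) :
    accelForm g q' ((extChartAt I q' ∘ (extChartAt I q).symm) ∘ F) x v w
      (fderivWithin ℝ (extChartAt I q' ∘ (extChartAt I q).symm) (range I) (F x) n) =
    accelForm g q F x v w n := by
  have hφ2 := contDiffWithinAt_transition (I := I) hx hx'
  have h1 := coordMetric_transition g hx hx'
  have h2 := koszul_transition g hx hx' rfl
  unfold accelForm
  -- The `D²φ` term of the chain rule equals the inhomogeneous term of `koszul_transition`.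
  rw [fderiv_fderiv_comp I.uniqueDiffOn hF hFr hφ2,
    (fderiv_comp_fderivWithin_eventually hF hFr hφ2).self_of_nhds, h1, h2, coordMetric_add_left]
  simp only [Function.comp_apply, ContinuousLinearMap.comp_apply]
  ring

/-- Behaviour of `accelForm` under a change of the chart of the source. -/
theorem accelForm_comp (g : RMetric I M) {q : M}
    {F : EuclideanSpace ℝ (Fin 2) → EuclideanSpace ℝ (Fin 3)}
    {ψ : EuclideanSpace ℝ (Fin 2) → EuclideanSpace ℝ (Fin 2)} {x : EuclideanSpace ℝ (Fin 2)}
    (hF : ContDiffAt ℝ 2 F (ψ x)) (hψ : ContDiffAt ℝ 2 ψ x)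
    {n : EuclideanSpace ℝ (Fin 3)} (hn : ∀ u, coordMetric g q (F (ψ x)) (fderiv ℝ F (ψ x) u) n = 0)
    (v w : EuclideanSpace ℝ (Fin 2)) :
    accelForm g q (F ∘ ψ) x v w n = accelForm g q F (ψ x) (fderiv ℝ ψ x v) (fderiv ℝ ψ x w) n := by
  unfold accelForm
  have hF' : ContDiffWithinAt ℝ 2 F univ (ψ x) := hF.contDiffWithinAt
  -- The extra term `DF(D²ψ)` is tangential, so the normality assumption `hn` removes it.
  rw [fderiv_fderiv_comp uniqueDiffOn_univ hψ (fun _ => mem_univ _) hF',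
    (fderiv_comp_fderivWithin_eventually hψ (fun _ => mem_univ _) hF').self_of_nhds]
  simp only [fderivWithin_univ, Function.comp_apply, ContinuousLinearMap.comp_apply,
    coordMetric_add_left, hn, add_zero, fderiv_fderiv_apply hF]

theorem secondForm_eq_accelForm (g : RMetric I M) {f : S → M} {p : S}
    (hf : MDifferentiableAt (𝓡 2) I f p) (ν : (p : S) → TangentSpace I (f p))
    (v w : TangentSpace (𝓡 2) p) :
    secondForm g f ν p v w =
      -accelForm g (f p) (writtenInExtChartAt (𝓡 2) I p f) (extChartAt (𝓡 2) p p) v w (ν p) := by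
  have hFx : writtenInExtChartAt (𝓡 2) I p f (extChartAt (𝓡 2) p p) = extChartAt I (f p) (f p) := by
    simp [writtenInExtChartAt]
  have hD : ∀ u : TangentSpace (𝓡 2) p, (mfderiv (𝓡 2) I f p u : EuclideanSpace ℝ (Fin 3)) =
      fderiv ℝ (writtenInExtChartAt (𝓡 2) I p f) (extChartAt (𝓡 2) p p) u := by
    intro u
    have h0 : fderivWithin ℝ (writtenInExtChartAt (𝓡 2) I p f) (range (𝓡 2))
        (extChartAt (𝓡 2) p p) = fderiv ℝ (writtenInExtChartAt (𝓡 2) I p f)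
        (extChartAt (𝓡 2) p p) := by
      rw [modelWithCornersSelf_coe, range_id, fderivWithin_univ]
    exact (DFunLike.congr_fun hf.mfderiv u).trans (DFunLike.congr_fun h0 u)
  have key : ∀ a b c n : EuclideanSpace ℝ (Fin 3),
      g.inner (f p) (a + christoffel g (f p) (extChartAt I (f p) (f p)) b c :
        EuclideanSpace ℝ (Fin 3)) n =
      coordMetric g (f p) (extChartAt I (f p) (f p)) a n
        + koszul g (f p) (extChartAt I (f p) (f p)) b c n := by
    intro a b c n
    rw [← coordMetric_christoffel g (mem_extChartAt_target (f p)), ← coordMetric_add_left]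
    exact (coordMetric_extChartAt_self g (f p) _ _).symm
  unfold secondForm accelForm
  rw [hFx]
  refine (congrArg Neg.neg (key _ _ _ _)).trans ?_
  rw [hD v, hD w]

end SecondForm

end BrownYork

/-! ### Metric traces in arbitrary charts and their continuity. -/

/-- The trace of a bilinear form with respect to an inner product does not depend on the basis. -/
theorem Matrix.sum_inv_mul_congr_basis {n : ℕ} (G C T : Matrix (Fin n) (Fin n) ℝ)
    (hT : IsUnit T.det) :
    ∑ i, ∑ j, (T.transpose * G * T)⁻¹ i j * (T.transpose * C * T) i j =
      ∑ i, ∑ j, G⁻¹ i j * C i j := by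
  have h : ∀ A B : Matrix (Fin n) (Fin n) ℝ,
      ∑ i, ∑ j, A i j * B i j = (A * B.transpose).trace := by
    intro A B
    simp [Matrix.trace, Matrix.mul_apply]
  rw [h, h]
  have h1 : T.transpose⁻¹ * T.transpose = 1 :=
    Matrix.nonsing_inv_mul _ (by rwa [Matrix.det_transpose])
  have h2 : T * T⁻¹ = 1 := Matrix.mul_nonsing_inv _ hT
  calc ((T.transpose * G * T)⁻¹ * (T.transpose * C * T).transpose).trace
      = (T⁻¹ * (G⁻¹ * (T.transpose⁻¹ * T.transpose) * C.transpose * T)).trace := by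
        simp only [Matrix.mul_inv_rev, Matrix.transpose_mul, Matrix.transpose_transpose,
          Matrix.mul_assoc]
    _ = (G⁻¹ * C.transpose * (T * T⁻¹)).trace := by
        rw [h1, Matrix.trace_mul_comm]
        simp only [Matrix.mul_assoc, Matrix.one_mul]
    _ = _ := by rw [h2, Matrix.mul_one]

namespace BrownYork

theorem bilin_eq_sum {n : ℕ}
    (C : EuclideanSpace ℝ (Fin n) →ₗ[ℝ] EuclideanSpace ℝ (Fin n) →ₗ[ℝ] ℝ)
    (u v : EuclideanSpace ℝ (Fin n)) :
    C u v = ∑ i, ∑ j, u i * C (e i) (e j) * v j := by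
  conv_lhs => rw [← (EuclideanSpace.basisFun (Fin n) ℝ).sum_repr u,
    ← (EuclideanSpace.basisFun (Fin n) ℝ).sum_repr v]
  simp only [map_sum, map_smul, LinearMap.sum_apply, LinearMap.smul_apply,
    smul_eq_mul, EuclideanSpace.basisFun_repr, EuclideanSpace.basisFun_apply, Finset.mul_sum]
  rw [Finset.sum_comm]
  exact Finset.sum_congr rfl fun i _ => Finset.sum_congr rfl fun j _ => by ring

section Trace

variable {n : ℕ} {H : Type*} [TopologicalSpace H]
  {I : ModelWithCorners ℝ (EuclideanSpace ℝ (Fin n)) H}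
  {M : Type*} [TopologicalSpace M] [ChartedSpace H M] [IsManifold I ∞ M]

/-- The trace of a bilinear form, computed in an arbitrary chart. -/
theorem traceForm_chart (g : RMetric I M) {q : M} {x : EuclideanSpace ℝ (Fin n)}
    (hx : x ∈ (extChartAt I q).target)
    (B : TangentSpace I ((extChartAt I q).symm x) → TangentSpace I ((extChartAt I q).symm x) → ℝ)
    (C : EuclideanSpace ℝ (Fin n) →ₗ[ℝ] EuclideanSpace ℝ (Fin n) →ₗ[ℝ] ℝ)
    (hB : ∀ v w : EuclideanSpace ℝ (Fin n),
      B (mfderivWithin 𝓘(ℝ, EuclideanSpace ℝ (Fin n)) I (extChartAt I q).symm (range I) x v)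
        (mfderivWithin 𝓘(ℝ, EuclideanSpace ℝ (Fin n)) I (extChartAt I q).symm (range I) x w) =
        C v w) :
    traceForm g ((extChartAt I q).symm x) B =
      ∑ i, ∑ j, (coordGram g q x)⁻¹ i j * C (e i) (e j) := by
  have := isManifold_one_of_smooth (I := I) (M := M)
  let p := (extChartAt I q).symm x
  have hps : p ∈ (extChartAt I q).source := (extChartAt I q).map_target hx
  have h1 := mfderivWithin_extChartAt_symm_comp_mfderiv_extChartAt (I := I) hx
  let τ : EuclideanSpace ℝ (Fin n) → EuclideanSpace ℝ (Fin n) := fun u =>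
    mfderiv I 𝓘(ℝ, EuclideanSpace ℝ (Fin n)) (extChartAt I q) p u
  have hτ : ∀ u : EuclideanSpace ℝ (Fin n),
      mfderivWithin 𝓘(ℝ, EuclideanSpace ℝ (Fin n)) I (extChartAt I q).symm (range I) x (τ u) = u :=
    fun u => DFunLike.congr_fun h1 u
  have hBC : ∀ u v : EuclideanSpace ℝ (Fin n), B u v = C (τ u) (τ v) := by
    intro u v
    rw [← hB, hτ, hτ]
  have hgG : ∀ u v : EuclideanSpace ℝ (Fin n), g.inner p u v = coordMetric g q x (τ u) (τ v) := by
    intro u v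
    unfold coordMetric
    rw [hτ, hτ]
  let T : Matrix (Fin n) (Fin n) ℝ := Matrix.of fun k i => τ (e i) k
  have hgram : gram g p = T.transpose * coordGram g q x * T := by
    ext i j
    simp only [gram, Matrix.of_apply, Matrix.mul_apply, Matrix.transpose_apply, Finset.sum_mul]
    rw [Finset.sum_comm]
    refine (hgG _ _).trans ((coordMetric_eq_sum g q x _ _).trans ?_)
    exact Finset.sum_congr rfl fun k _ => Finset.sum_congr rfl fun l _ => by
      simp only [T, Matrix.of_apply]; ring
  have hBm : ∀ i j, B (e i : EuclideanSpace ℝ (Fin n)) (e j : EuclideanSpace ℝ (Fin n)) =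
      (T.transpose * (Matrix.of fun k l => C (e k) (e l)) * T) i j := by
    intro i j
    rw [hBC, bilin_eq_sum]
    simp only [Matrix.of_apply, Matrix.mul_apply, Matrix.transpose_apply, Finset.sum_mul]
    rw [Finset.sum_comm]
    rfl
  -- The product `Tᵀ G T` is the Gram matrix at `p`, whose determinant is positive; so `det T`
  -- cannot vanish.
  have hT : IsUnit T.det := by
    have h2 := (coordGram_posDef g (mem_extChartAt_target (I := I) p)).det_pos
    rw [← gram_eq_coordGram, hgram, Matrix.det_mul, Matrix.det_mul] at h2
    exact isUnit_iff_ne_zero.2 fun h => by simp [h] at h2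
  have key := Matrix.sum_inv_mul_congr_basis (coordGram g q x)
    (Matrix.of fun k l => C (e k) (e l)) T hT
  rw [← hgram] at key
  simp only [← hBm, Matrix.of_apply] at key
  exact key

theorem continuousAt_coordGram_inv (g : RMetric I M) [I.Boundaryless] {q : M}
    {x : EuclideanSpace ℝ (Fin n)} (hx : x ∈ (extChartAt I q).target) (i j : Fin n) :
    ContinuousAt (fun y => (coordGram g q y)⁻¹ i j) x := by
  have h1 : ContinuousAt (coordGram g q) x := by
    refine continuousAt_pi.2 fun i => continuousAt_pi.2 fun j => ?_
    exact ((contDiffOn_coordMetric g q (e i) (e j)).continuousOn x hx).continuousAt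
      (extChartAt_target_mem_nhds' hx)
  have h2 : ContinuousAt Ring.inverse (coordGram g q x).det := by
    have := (coordGram_posDef g hx).det_pos.ne'.isUnit
    exact NormedRing.inverse_continuousAt this.unit
  have h3 : ContinuousAt (fun y => Ring.inverse (coordGram g q y).det) x :=
    ContinuousAt.comp (g := Ring.inverse) h2
      ((Continuous.matrix_det continuous_id).continuousAt.comp h1)
  simp only [Matrix.inv_def, Matrix.smul_apply, smul_eq_mul]
  refine h3.mul ?_
  have h4 : Continuous fun A : Matrix (Fin n) (Fin n) ℝ => A.adjugate i j :=
    (Continuous.matrix_adjugate continuous_id).matrix_elem i j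
  exact h4.continuousAt.comp h1

/-- A function which is locally the trace of continuous bilinear forms is continuous. -/
theorem continuous_traceForm (g : RMetric I M) [I.Boundaryless]
    (B : ∀ p : M, TangentSpace I p → TangentSpace I p → ℝ)
    (hB : ∀ q : M, ∃ C : EuclideanSpace ℝ (Fin n) →
        EuclideanSpace ℝ (Fin n) →ₗ[ℝ] EuclideanSpace ℝ (Fin n) →ₗ[ℝ] ℝ,
      (∀ i j, ContinuousAt (fun x => C x (e i) (e j)) (extChartAt I q q)) ∧
      ∀ᶠ x in nhds (extChartAt I q q), ∀ v w : EuclideanSpace ℝ (Fin n),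
        B ((extChartAt I q).symm x)
          (mfderivWithin 𝓘(ℝ, EuclideanSpace ℝ (Fin n)) I (extChartAt I q).symm (range I) x v)
          (mfderivWithin 𝓘(ℝ, EuclideanSpace ℝ (Fin n)) I (extChartAt I q).symm (range I) x w) =
          C x v w) :
    Continuous fun p => traceForm g p (B p) := by
  rw [continuous_iff_continuousAt]
  intro q
  obtain ⟨C, hC, hBC⟩ := hB q
  have h1 : ContinuousAt (fun x => ∑ i, ∑ j, (coordGram g q x)⁻¹ i j * C x (e i) (e j))
      (extChartAt I q q) :=
    tendsto_finsetSum _ fun i _ => tendsto_finsetSum _ fun j _ =>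
      (continuousAt_coordGram_inv g (mem_extChartAt_target q) i j).mul (hC i j)
  refine (ContinuousAt.comp (f := extChartAt I q) h1 (continuousAt_extChartAt q)).congr ?_
  filter_upwards [(continuousAt_extChartAt (I := I) q).eventually hBC,
    extChartAt_source_mem_nhds (I := I) q] with p hp hps
  have h2 := traceForm_chart g ((extChartAt I q).map_source hps) _ (C (extChartAt I q p)) hp
  rw [(extChartAt I q).left_inv hps] at h2
  exact h2.symm

end Trace

end BrownYork

/-! ### Continuity of the mean curvature in the ambient manifold. -/

theorem continuousAt_fderivWithin_apply {P E G : Type*} [TopologicalSpace P]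
    [NormedAddCommGroup E] [NormedSpace ℝ E] [NormedAddCommGroup G] [NormedSpace ℝ G]
    {f : E → G} {s : Set E} {F u : P → E} {x : P} (hs : UniqueDiffOn ℝ s)
    (hf : ContDiffWithinAt ℝ 1 f s (F x)) (hF : ContinuousAt F x) (hFs : ∀ y, F y ∈ s)
    (hu : ContinuousAt u x) : ContinuousAt (fun y => fderivWithin ℝ f s (F y) (u y)) x := by
  have h1 : Filter.Tendsto F (nhds x) (nhdsWithin (F x) s) :=
    tendsto_nhdsWithin_iff.2 ⟨hF, Filter.Eventually.of_forall hFs⟩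
  have h2 := (hf.fderivWithin_right (m := 0) hs (by norm_num) (hFs x)).continuousWithinAt
  have h3 : ContinuousAt (fun y => fderivWithin ℝ f s (F y)) x := h2.tendsto.comp h1
  exact h3.clm_apply hu

namespace BrownYork

section AmbientSurface

variable {H : Type*} [TopologicalSpace H]
  {I : ModelWithCorners ℝ (EuclideanSpace ℝ (Fin 3)) H}
  {M : Type*} [TopologicalSpace M] [ChartedSpace H M] [IsManifold I ∞ M]
  {S : Type*} [TopologicalSpace S] [ChartedSpace (EuclideanSpace ℝ (Fin 2)) S]
  [IsManifold (𝓡 2) ∞ S]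

theorem accelForm_congr (g : RMetric I M) {q : M}
    {F F' : EuclideanSpace ℝ (Fin 2) → EuclideanSpace ℝ (Fin 3)} {x : EuclideanSpace ℝ (Fin 2)}
    (h : F =ᶠ[nhds x] F') (v w : EuclideanSpace ℝ (Fin 2)) (n : EuclideanSpace ℝ (Fin 3)) :
    accelForm g q F x v w n = accelForm g q F' x v w n := by
  have h1 : (fun y => fderiv ℝ F y w) =ᶠ[nhds x] fun y => fderiv ℝ F' y w :=
    (h.fderiv (𝕜 := ℝ)).mono fun y hy => by simp only [hy]
  simp only [accelForm, h1.fderiv_eq (𝕜 := ℝ), h.fderiv_eq (𝕜 := ℝ), h.self_of_nhds]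

theorem koszul_add_left (g : RMetric I M) {q : M} {x : EuclideanSpace ℝ (Fin 3)}
    (hx : x ∈ (extChartAt I q).target) (u u' v w : EuclideanSpace ℝ (Fin 3)) :
    koszul g q x (u + u') v w = koszul g q x u v w + koszul g q x u' v w := by
  simp only [koszul, dCoordMetric_eq g hx, map_add, add_apply]
  ring

theorem koszul_smul_left (g : RMetric I M) {q : M} {x : EuclideanSpace ℝ (Fin 3)}
    (hx : x ∈ (extChartAt I q).target) (c : ℝ) (u v w : EuclideanSpace ℝ (Fin 3)) :
    koszul g q x (c • u) v w = c * koszul g q x u v w := by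
  simp only [koszul, dCoordMetric_eq g hx, map_smul, smul_apply, smul_eq_mul]
  ring

theorem koszul_add_middle (g : RMetric I M) {q : M} {x : EuclideanSpace ℝ (Fin 3)}
    (hx : x ∈ (extChartAt I q).target) (u v v' w : EuclideanSpace ℝ (Fin 3)) :
    koszul g q x u (v + v') w = koszul g q x u v w + koszul g q x u v' w := by
  simp only [koszul, dCoordMetric_eq g hx, map_add, add_apply]
  ring

theorem koszul_smul_middle (g : RMetric I M) {q : M} {x : EuclideanSpace ℝ (Fin 3)}
    (hx : x ∈ (extChartAt I q).target) (c : ℝ) (u v w : EuclideanSpace ℝ (Fin 3)) :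
    koszul g q x u (c • v) w = c * koszul g q x u v w := by
  simp only [koszul, dCoordMetric_eq g hx, map_smul, smul_apply, smul_eq_mul]
  ring

/-- The form `-accelForm` as a bilinear form in the coordinate vectors. -/
noncomputable def secondFormBilin (g : RMetric I M) {q : M}
    {F : EuclideanSpace ℝ (Fin 2) → EuclideanSpace ℝ (Fin 3)} {x : EuclideanSpace ℝ (Fin 2)}
    (hF : ContDiffAt ℝ 2 F x) (hx : F x ∈ (extChartAt I q).target)
    (n : EuclideanSpace ℝ (Fin 3)) :
    EuclideanSpace ℝ (Fin 2) →ₗ[ℝ] EuclideanSpace ℝ (Fin 2) →ₗ[ℝ] ℝ :=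
  LinearMap.mk₂ ℝ (fun v w => -accelForm g q F x v w n)
    (fun v v' w => by
      simp only [accelForm, fderiv_fderiv_apply hF]
      simp only [map_add, add_apply, coordMetric_add_left,
        koszul_add_left g hx]
      ring)
    (fun c v w => by
      simp only [accelForm, fderiv_fderiv_apply hF]
      simp only [map_smul, smul_apply, coordMetric_smul_left,
        koszul_smul_left g hx, smul_eq_mul]
      ring)
    (fun v w w' => by
      simp only [accelForm, fderiv_fderiv_apply hF]
      simp only [map_add, coordMetric_add_left,
        koszul_add_middle g hx]
      ring)
    (fun c v w => by
      simp only [accelForm, fderiv_fderiv_apply hF]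
      simp only [map_smul, coordMetric_smul_left,
        koszul_smul_middle g hx, smul_eq_mul]
      ring)

theorem contDiffAt_transition {q q' : S} {x : EuclideanSpace ℝ (Fin 2)}
    (hx : x ∈ (extChartAt (𝓡 2) q).target)
    (hx' : (extChartAt (𝓡 2) q).symm x ∈ (extChartAt (𝓡 2) q').source) :
    ContDiffAt ℝ 2 (extChartAt (𝓡 2) q' ∘ (extChartAt (𝓡 2) q).symm) x := by
  have := contDiffWithinAt_transition (I := 𝓡 2) hx hx'
  rwa [modelWithCornersSelf_coe, range_id, contDiffWithinAt_univ] at this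

theorem contDiffAt_inCharts {f : S → M} (hf : ContMDiff (𝓡 2) I ∞ f) {q : S} {q' : M}
    {x : EuclideanSpace ℝ (Fin 2)} (hx : x ∈ (extChartAt (𝓡 2) q).target)
    (hx' : f ((extChartAt (𝓡 2) q).symm x) ∈ (extChartAt I q').source) :
    ContDiffAt ℝ ∞ (extChartAt I q' ∘ f ∘ (extChartAt (𝓡 2) q).symm) x := by
  rw [← contMDiffAt_iff_contDiffAt]
  have h1 : ContMDiffAt (𝓡 2) (𝓡 2) ∞ (extChartAt (𝓡 2) q).symm x :=
    ((contMDiffOn_extChartAt_symm q) x hx).contMDiffAt (extChartAt_target_mem_nhds' hx)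
  have h2 : ContMDiffAt I (𝓡 3) ∞ (extChartAt I q') (f ((extChartAt (𝓡 2) q).symm x)) :=
    contMDiffAt_extChartAt' (by simpa using hx')
  exact h2.comp x (hf.contMDiffAt.comp x h1)

omit [IsManifold (𝓡 2) ∞ S] [IsManifold I ∞ M] in
theorem eventually_mem_source_inCharts {f : S → M} (hf : Continuous f) {q : S} {q' : M}
    {x : EuclideanSpace ℝ (Fin 2)} (hx : x ∈ (extChartAt (𝓡 2) q).target)
    (hx' : f ((extChartAt (𝓡 2) q).symm x) ∈ (extChartAt I q').source) :
    ∀ᶠ y in nhds x, f ((extChartAt (𝓡 2) q).symm y) ∈ (extChartAt I q').source :=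
  (hf.continuousAt.comp (continuousAt_extChartAt_symm'' hx)).eventually
    ((isOpen_extChartAt_source q').mem_nhds hx')

theorem mfderiv_extChartAt_eq_transition (p q' : M) (hp : p ∈ (extChartAt I q').source)
    (u : TangentSpace I p) :
    fderivWithin ℝ (extChartAt I q' ∘ (extChartAt I p).symm) (range I) (extChartAt I p p) u =
      mfderiv I 𝓘(ℝ, EuclideanSpace ℝ (Fin 3)) (extChartAt I q') p u := by
  have := isManifold_one_of_smooth (I := I) (M := M)
  have h := mfderiv_comp_mfderivWithin_of_eq (I := 𝓘(ℝ, EuclideanSpace ℝ (Fin 3))) (I' := I)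
    (I'' := 𝓘(ℝ, EuclideanSpace ℝ (Fin 3))) (x := extChartAt I p p) (y := p)
    (mdifferentiableAt_extChartAt (I := I) (x := q') (by simpa using hp))
    (mdifferentiableWithinAt_extChartAt_symm (mem_extChartAt_target p))
    (I.uniqueMDiffOn _ (mem_range_self _)) (by simp)
  rw [mfderivWithin_range_extChartAt_symm] at h
  rw [← mfderivWithin_eq_fderivWithin]
  exact DFunLike.congr_fun h u

theorem fderiv_transition_self {q p : S} {x : EuclideanSpace ℝ (Fin 2)}
    (hx : x ∈ (extChartAt (𝓡 2) q).target) (hp : p = (extChartAt (𝓡 2) q).symm x)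
    (u : EuclideanSpace ℝ (Fin 2)) :
    fderiv ℝ (extChartAt (𝓡 2) p ∘ (extChartAt (𝓡 2) q).symm) x u =
      mfderivWithin (𝓡 2) (𝓡 2) (extChartAt (𝓡 2) q).symm (range (𝓡 2)) x u := by
  have := isManifold_one_of_smooth (I := 𝓡 2) (M := S)
  subst hp
  have e1 := mfderiv_extChartAt_frame (I := 𝓡 2) hx (mem_extChartAt_source _) u
  rw [mfderiv_extChartAt_self] at e1
  refine Eq.trans ?_ e1.symm
  rw [modelWithCornersSelf_coe, range_id, fderivWithin_univ]

-- The expression of `f` in any pair of charts factors near `x` through its expression in the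
-- preferred charts at `p` and `f p`, with a transition map on either side. The two change-of-chart
-- rules for `accelForm` can then be applied.
omit [IsManifold (𝓡 2) ∞ S] [IsManifold I ∞ M] in
theorem inCharts_eventuallyEq {f : S → M} (hf : Continuous f) {q p : S} (q' : M)
    {x : EuclideanSpace ℝ (Fin 2)} (hx : x ∈ (extChartAt (𝓡 2) q).target)
    (hp : p = (extChartAt (𝓡 2) q).symm x) :
    extChartAt I q' ∘ f ∘ (extChartAt (𝓡 2) q).symm =ᶠ[nhds x]
      (extChartAt I q' ∘ (extChartAt I (f p)).symm) ∘ writtenInExtChartAt (𝓡 2) I p f ∘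
        (extChartAt (𝓡 2) p ∘ (extChartAt (𝓡 2) q).symm) := by
  subst hp
  have e1 := eventually_mem_source_inCharts (I := I) hf hx (mem_extChartAt_source _)
  have e2 := (continuousAt_extChartAt_symm'' (I := 𝓡 2) hx).eventually
    ((isOpen_extChartAt_source _).mem_nhds (mem_extChartAt_source (I := 𝓡 2) _))
  filter_upwards [e1, e2] with y hy1 hy2
  have e3 := (extChartAt (𝓡 2) _).left_inv hy2
  have e4 := (extChartAt I _).left_inv hy1
  simp only [Function.comp_apply, writtenInExtChartAt, e3, e4]

/-- The second fundamental form, computed in arbitrary charts. -/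
theorem secondForm_inCharts (g : RMetric I M) {f : S → M} (hf : ContMDiff (𝓡 2) I ∞ f)
    {ν : (p : S) → TangentSpace I (f p)}
    (hν : ∀ (p : S) (v : TangentSpace (𝓡 2) p), g.inner (f p) (ν p) (mfderiv (𝓡 2) I f p v) = 0)
    {q : S} {q' : M} {x : EuclideanSpace ℝ (Fin 2)} (hx : x ∈ (extChartAt (𝓡 2) q).target)
    (hx' : f ((extChartAt (𝓡 2) q).symm x) ∈ (extChartAt I q').source)
    (v w : EuclideanSpace ℝ (Fin 2)) :
    secondForm g f ν ((extChartAt (𝓡 2) q).symm x)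
      (mfderivWithin (𝓡 2) (𝓡 2) (extChartAt (𝓡 2) q).symm (range (𝓡 2)) x v)
      (mfderivWithin (𝓡 2) (𝓡 2) (extChartAt (𝓡 2) q).symm (range (𝓡 2)) x w) =
    -accelForm g q' (extChartAt I q' ∘ f ∘ (extChartAt (𝓡 2) q).symm) x v w
      (mfderiv I 𝓘(ℝ, EuclideanSpace ℝ (Fin 3)) (extChartAt I q')
        (f ((extChartAt (𝓡 2) q).symm x)) (ν ((extChartAt (𝓡 2) q).symm x))) := by
  have hfd : ∀ p, MDifferentiableAt (𝓡 2) I f p := fun p => hf.mdifferentiableAt (by norm_num)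
  rw [secondForm_eq_accelForm g (hfd _)]
  congr 1
  obtain ⟨p, hp⟩ : ∃ p, p = (extChartAt (𝓡 2) q).symm x := ⟨_, rfl⟩
  let F := writtenInExtChartAt (𝓡 2) I p f
  let ψ := extChartAt (𝓡 2) p ∘ (extChartAt (𝓡 2) q).symm
  have hψ : ContDiffAt ℝ 2 ψ x := contDiffAt_transition hx (hp ▸ mem_extChartAt_source p)
  have hψx : ψ x = extChartAt (𝓡 2) p p := by simp only [ψ, Function.comp_apply, hp]
  have hF : ContDiffAt ℝ 2 F (ψ x) := by
    rw [hψx]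
    exact (contDiffAt_inCharts hf (mem_extChartAt_target p) (by simp)).of_le (by norm_cast)
  have hFx : F (ψ x) = extChartAt I (f p) (f p) := by
    rw [hψx]; simp [F, writtenInExtChartAt]
  have hfp : f p ∈ (extChartAt I q').source := hp ▸ hx'
  -- Normality of `ν` to the image of `dF`, read in the chart at `f p`; `accelForm_comp` needs it to
  -- change the chart of the source.
  have hn : ∀ u, coordMetric g (f p) (F (ψ x)) (fderiv ℝ F (ψ x) u) (ν p) = 0 := by
    intro u
    rw [hFx]
    refine (coordMetric_symm g (f p) _ _ _).trans ?_
    refine (coordMetric_extChartAt_self g (f p) _ _).trans (Eq.trans ?_ (hν p u))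
    refine congrArg (g.inner (f p) (ν p)) ?_
    refine Eq.trans ?_ (DFunLike.congr_fun (hfd p).mfderiv u).symm
    rw [hψx, modelWithCornersSelf_coe, range_id, fderivWithin_univ]
    rfl
  have hFr : ∀ y, F y ∈ range I := fun y => by simp [F, writtenInExtChartAt]
  have h1 := accelForm_comp g hF hψ hn v w
  have h2 := accelForm_transition g (hF.comp x hψ) (fun y => hFr (ψ y))
    (q := f p) (q' := q') (by rw [Function.comp_apply, hFx]; exact mem_extChartAt_target _)
    (by rw [Function.comp_apply, hFx]; simpa using hfp) v w (ν p)
  have h3 := inCharts_eventuallyEq (I := I) hf.continuous q' hx hp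
  have hD : ∀ u, fderiv ℝ ψ x u =
      mfderivWithin (𝓡 2) (𝓡 2) (extChartAt (𝓡 2) q).symm (range (𝓡 2)) x u :=
    fderiv_transition_self hx hp
  have h4 : fderivWithin ℝ (extChartAt I q' ∘ (extChartAt I (f p)).symm) (range I) ((F ∘ ψ) x)
      (ν p) = mfderiv I 𝓘(ℝ, EuclideanSpace ℝ (Fin 3)) (extChartAt I q') (f p) (ν p) := by
    rw [Function.comp_apply, hFx]
    exact mfderiv_extChartAt_eq_transition _ _ hfp _
  rw [h1, hψx, hD, hD] at h2
  subst hp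
  refine h2.symm.trans (Eq.trans ?_ (accelForm_congr g h3 _ _ _).symm)
  exact congrArg (accelForm g q' _ x v w) h4

omit [ChartedSpace (EuclideanSpace ℝ (Fin 2)) S] [IsManifold (𝓡 2) ∞ S] in
/-- The components of a continuous field along `f` in a chart are continuous. -/
theorem continuousAt_field_inChart {f : S → M} {ν : (p : S) → TangentSpace I (f p)}
    (hν : Continuous fun p => (⟨f p, ν p⟩ : TangentBundle I M)) (q : S) :
    ContinuousAt (fun p => (mfderiv I 𝓘(ℝ, EuclideanSpace ℝ (Fin 3)) (extChartAt I (f q))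
      (f p) (ν p) : EuclideanSpace ℝ (Fin 3))) q := by
  have := isManifold_one_of_smooth (I := I) (M := M)
  have h1 := (FiberBundle.continuousAt_totalSpace (EuclideanSpace ℝ (Fin 3)) _).1 (hν.continuousAt (x := q))
  refine h1.2.congr ?_
  filter_upwards [h1.1.eventually ((chartAt H (f q)).open_source.mem_nhds
    (mem_chart_source H (f q)))] with p hp
  -- The trivialization of the tangent bundle at `f q` acts on fibres as the differential of the
  -- preferred chart, so its second component is the field in question.
  have h2 := DFunLike.congr_fun (TangentBundle.continuousLinearMapAt_trivializationAt (I := I) hp)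
    (ν p)
  refine Eq.trans ?_ h2
  have h3 := Bundle.Trivialization.coe_linearMapAt_of_mem (R := ℝ)
    (trivializationAt (EuclideanSpace ℝ (Fin 3)) (TangentSpace I) (f q)) (b := f p)
    (by simpa using (show f p ∈ (chartAt H (f q)).source from hp))
  exact (congrFun h3 (ν p)).symm

/-- The form is a polynomial expression in the first two derivatives of `F`, the field `n`, and the
metric with its one-sided derivative along `F`. The latter is continuous because `F` stays in `range
I`. -/
theorem continuousAt_accelForm (g : RMetric I M) {q : M}
    {F n : EuclideanSpace ℝ (Fin 2) → EuclideanSpace ℝ (Fin 3)} {x : EuclideanSpace ℝ (Fin 2)}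
    (hF : ContDiffAt ℝ 2 F x) (hFr : ∀ y, F y ∈ range I) (hx : F x ∈ (extChartAt I q).target)
    (hn : ContinuousAt n x) (v w : EuclideanSpace ℝ (Fin 2)) :
    ContinuousAt (fun y => accelForm g q F y v w (n y)) x := by
  have hFt : Filter.Tendsto F (nhds x) (nhdsWithin (F x) (range I)) :=
    tendsto_nhdsWithin_iff.2 ⟨hF.continuousAt, Filter.Eventually.of_forall hFr⟩
  have h1 : ContDiffWithinAt ℝ 1 (coordForm g q) (range I) (F x) :=
    ((contDiffOn_coordForm g q (F x) hx).mono_of_mem_nhdsWithin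
      (extChartAt_target_mem_nhdsWithin_of_mem hx)).of_le (by norm_cast)
  have h3 : ContinuousAt (fun y => coordForm g q (F y)) x := h1.continuousWithinAt.tendsto.comp hFt
  have h4 := fun {u} => continuousAt_fderivWithin_apply (u := u) I.uniqueDiffOn h1 hF.continuousAt
    hFr
  have h5 : ContDiffAt ℝ 1 (fderiv ℝ F) x := hF.fderiv_right (by norm_num)
  have h6 : ContinuousAt (fderiv ℝ (fderiv ℝ F)) x :=
    (h5.fderiv_right (m := 0) (by norm_num)).continuousAt
  have h7 : ∀ u, ContinuousAt (fun y => fderiv ℝ F y u) x := fun u =>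
    h5.continuousAt.clm_apply continuousAt_const
  have h8 := h6.clm_apply (continuousAt_const (y := v)) |>.clm_apply (continuousAt_const (y := w))
  have h9 : ContinuousAt (fun y => coordForm g q (F y) (fderiv ℝ (fderiv ℝ F) y v w) (n y)
      + (fderivWithin ℝ (coordForm g q) (range I) (F y) (fderiv ℝ F y v) (fderiv ℝ F y w) (n y)
        + fderivWithin ℝ (coordForm g q) (range I) (F y) (fderiv ℝ F y w) (fderiv ℝ F y v) (n y)
        - fderivWithin ℝ (coordForm g q) (range I) (F y) (n y) (fderiv ℝ F y v)
            (fderiv ℝ F y w)) / 2) x :=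
    ((h3.clm_apply h8).clm_apply hn).add ((((((h4 (h7 v)).clm_apply (h7 w)).clm_apply
      hn).add (((h4 (h7 w)).clm_apply (h7 v)).clm_apply hn)).sub
      (((h4 hn).clm_apply (h7 v)).clm_apply (h7 w))).div_const 2)
  refine h9.congr ?_
  filter_upwards [hF.eventually (by simp),
    hFt.eventually (extChartAt_target_mem_nhdsWithin_of_mem hx)] with y hy1 hy2
  simp only [accelForm, koszul, dCoordMetric_eq g hy2, fderiv_fderiv_apply hy1, coordForm_apply]

/-- By `secondForm_inCharts` the charts at `q` and `f q` can be used for all nearby points, and in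
fixed charts both the bilinear form and the inverse metric vary continuously. -/
theorem continuous_meanCurvature (σ : RMetric (𝓡 2) S) (g : RMetric I M) {f : S → M}
    (hf : ContMDiff (𝓡 2) I ∞ f) {ν : (p : S) → TangentSpace I (f p)} (hν : IsUnitNormal g f ν) :
    Continuous (meanCurvature σ g f ν) := by
  refine continuous_traceForm σ (fun p => secondForm g f ν p) fun q => ?_
  let F := extChartAt I (f q) ∘ f ∘ (extChartAt (𝓡 2) q).symm
  let n : EuclideanSpace ℝ (Fin 2) → EuclideanSpace ℝ (Fin 3) := fun x =>
    mfderiv I 𝓘(ℝ, EuclideanSpace ℝ (Fin 3)) (extChartAt I (f q))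
      (f ((extChartAt (𝓡 2) q).symm x)) (ν ((extChartAt (𝓡 2) q).symm x))
  have hx := mem_extChartAt_target (I := 𝓡 2) q
  have hqs : f ((extChartAt (𝓡 2) q).symm (extChartAt (𝓡 2) q q)) ∈ (extChartAt I (f q)).source := by
    simp
  have hF : ContDiffAt ℝ 2 F (extChartAt (𝓡 2) q q) :=
    (contDiffAt_inCharts hf hx hqs).of_le (by norm_cast)
  have hFr : ∀ y, F y ∈ range I := fun y => by simp [F]
  have hn : ContinuousAt n (extChartAt (𝓡 2) q q) := by
    have h1 := continuousAt_field_inChart hν.contMDiff.continuous q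
    exact ContinuousAt.comp_of_eq h1 (continuousAt_extChartAt_symm q) (by simp)
  classical
  -- Bilinearity is only known where `F` is `C²` with values in the chart target. The value `0`
  -- elsewhere is harmless, as only a neighbourhood of the base point matters.
  let C : EuclideanSpace ℝ (Fin 2) →
      EuclideanSpace ℝ (Fin 2) →ₗ[ℝ] EuclideanSpace ℝ (Fin 2) →ₗ[ℝ] ℝ := fun x =>
    if h : ContDiffAt ℝ 2 F x ∧ F x ∈ (extChartAt I (f q)).target then
      secondFormBilin g h.1 h.2 (n x) else 0
  have hev : ∀ᶠ x in nhds (extChartAt (𝓡 2) q q), ∀ v w, C x v w =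
      -accelForm g (f q) F x v w (n x) := by
    filter_upwards [hF.eventually (by simp),
      eventually_mem_source_inCharts (I := I) hf.continuous hx hqs] with x h1 h2 v w
    have h : ContDiffAt ℝ 2 F x ∧ F x ∈ (extChartAt I (f q)).target :=
      ⟨h1, (extChartAt I (f q)).map_source h2⟩
    simp only [C, dif_pos h]
    rfl
  refine ⟨C, fun i j => ?_, ?_⟩
  · refine ContinuousAt.congr (f := fun x => -accelForm g (f q) F x (e i) (e j) (n x)) ?_
      (hev.mono fun x hx => (hx _ _).symm)
    exact (continuousAt_accelForm g hF hFr
      ((extChartAt I (f q)).map_source hqs) hn _ _).neg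
  · filter_upwards [hev, eventually_mem_source_inCharts (I := I) hf.continuous hx hqs,
      extChartAt_target_mem_nhds (I := 𝓡 2) q] with x h1 h2 h3 v w
    rw [h1]
    exact secondForm_inCharts g hf hν.normal h3 h2 v w

end AmbientSurface

end BrownYork

namespace BrownYork

/-! ### The volume measure in charts. -/

section Volume

variable {n : ℕ} {H : Type*} [TopologicalSpace H]
  {I : ModelWithCorners ℝ (EuclideanSpace ℝ (Fin n)) H} [I.Boundaryless]
  {M : Type*} [TopologicalSpace M] [ChartedSpace H M]
  [MeasurableSpace M] [BorelSpace M]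

omit [I.Boundaryless] [MeasurableSpace M] [BorelSpace M] in
theorem continuousOn_coordGram_det [IsManifold I ∞ M] (g : RMetric I M) (q : M) :
    ContinuousOn (fun x => (coordGram g q x).det) (extChartAt I q).target := by
  have h1 : ContinuousOn (coordGram g q) (extChartAt I q).target :=
    continuousOn_pi.2 fun i => continuousOn_pi.2 fun j =>
      (contDiffOn_coordMetric g q (e i) (e j)).continuousOn
  exact (Continuous.matrix_det continuous_id).comp_continuousOn h1

/-- The measure given by the Riemannian density in the preferred chart at `q`. -/
noncomputable def chartMeasure [IsManifold I ∞ M] (g : RMetric I M) (q : M) : Measure M :=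
  (((volume : Measure (EuclideanSpace ℝ (Fin n))).restrict
      (extChartAt I q).target).withDensity
    (fun x => ENNReal.ofReal (Real.sqrt (coordGram g q x).det))).map (extChartAt I q).symm

theorem measurableSet_target_inter_preimage (q : M) {s : Set M} (hs : MeasurableSet s) :
    MeasurableSet ((extChartAt I q).target ∩ (extChartAt I q).symm ⁻¹' s) := by
  have h1 := (continuousOn_iff_continuous_domRestrict.1
    (continuousOn_extChartAt_symm (I := I) q)).measurable hs
  have h2 := MeasurableSet.subtype_image (isOpen_extChartAt_target (I := I) q).measurableSet h1
  convert h2 using 1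
  ext x
  simp [and_comm]

theorem aemeasurable_extChartAt_symm (q : M) :
    AEMeasurable (extChartAt I q).symm
      ((volume : Measure (EuclideanSpace ℝ (Fin n))).restrict (extChartAt I q).target) :=
  (continuousOn_extChartAt_symm q).aemeasurable (isOpen_extChartAt_target q).measurableSet

variable [IsManifold I ∞ M]

omit [MeasurableSpace M] [BorelSpace M] in
theorem aemeasurable_density (g : RMetric I M) (q : M) :
    AEMeasurable (fun x => ENNReal.ofReal (Real.sqrt (coordGram g q x).det))
      ((volume : Measure (EuclideanSpace ℝ (Fin n))).restrict (extChartAt I q).target) :=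
  ((Real.continuous_sqrt.comp_continuousOn (continuousOn_coordGram_det g q)).aemeasurable
    (isOpen_extChartAt_target q).measurableSet).ennreal_ofReal

theorem chartMeasure_apply (g : RMetric I M) (q : M) {s : Set M} (hs : MeasurableSet s) :
    chartMeasure g q s = ∫⁻ x in (extChartAt I q).target ∩ (extChartAt I q).symm ⁻¹' s,
      ENNReal.ofReal (Real.sqrt (coordGram g q x).det) := by
  rw [chartMeasure, Measure.map_apply_of_aemeasurable
    ((aemeasurable_extChartAt_symm q).mono_ac (withDensity_absolutelyContinuous _ _)) hs,
    withDensity_apply', Measure.restrict_restrict'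
    (isOpen_extChartAt_target q).measurableSet, inter_comm]

omit [MeasurableSpace M] [BorelSpace M] in
theorem coordGram_det_transition (g : RMetric I M) {q q' : M} {x : EuclideanSpace ℝ (Fin n)}
    (hx : x ∈ (extChartAt I q).target)
    (hx' : (extChartAt I q).symm x ∈ (extChartAt I q').source) :
    (coordGram g q x).det =
      (fderiv ℝ (extChartAt I q' ∘ (extChartAt I q).symm) x).det ^ 2 *
        (coordGram g q' ((extChartAt I q' ∘ (extChartAt I q).symm) x)).det := by
  set D := fderiv ℝ (extChartAt I q' ∘ (extChartAt I q).symm) x with hD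
  let T : Matrix (Fin n) (Fin n) ℝ := Matrix.of fun k i => D (e i) k
  have h1 : coordGram g q x =
      T.transpose * coordGram g q' ((extChartAt I q' ∘ (extChartAt I q).symm) x) * T := by
    ext i j
    simp only [Matrix.mul_apply, Matrix.transpose_apply, Finset.sum_mul]
    rw [Finset.sum_comm]
    refine (coordMetric_transition g hx hx' _ _).trans ((coordMetric_eq_sum g q' _ _ _).trans ?_)
    rw [I.range_eq_univ, fderivWithin_univ, ← hD]
    exact Finset.sum_congr rfl fun k _ => Finset.sum_congr rfl fun l _ => by
      simp only [T, Matrix.of_apply]; ring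
  have h2 : D.det = T.det := by
    rw [ContinuousLinearMap.det, ← LinearMap.det_toMatrix
      (EuclideanSpace.basisFun (Fin n) ℝ).toBasis]
    congr 1
  rw [h1, Matrix.det_mul, Matrix.det_mul, Matrix.det_transpose, h2]
  ring

/-- Under the transition map the density `√det g` is multiplied by `|det Dφ|`, exactly the Jacobian
in the change of variables formula. -/
theorem chartMeasure_eq_of_subset (g : RMetric I M) {q q' : M} {s : Set M} (hs : MeasurableSet s)
    (hq : s ⊆ (extChartAt I q).source) (hq' : s ⊆ (extChartAt I q').source) :
    chartMeasure g q' s = chartMeasure g q s := by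
  rw [chartMeasure_apply g q hs, chartMeasure_apply g q' hs]
  set A := (extChartAt I q).target ∩ (extChartAt I q).symm ⁻¹' s with hA
  let φ := extChartAt I q' ∘ (extChartAt I q).symm
  have hAm : MeasurableSet A := measurableSet_target_inter_preimage q hs
  have himg : φ '' A = (extChartAt I q').target ∩ (extChartAt I q').symm ⁻¹' s := by
    ext y
    constructor
    · rintro ⟨x, ⟨_, hx2⟩, rfl⟩
      refine ⟨(extChartAt I q').map_source (hq' hx2), ?_⟩
      simp only [φ, Function.comp_apply, mem_preimage]
      rwa [(extChartAt I q').left_inv (hq' hx2)]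
    · rintro ⟨hy1, hy2⟩
      have h1 := (extChartAt I q).left_inv (hq hy2)
      refine ⟨extChartAt I q ((extChartAt I q').symm y),
        ⟨(extChartAt I q).map_source (hq hy2), ?_⟩, ?_⟩
      · rw [mem_preimage, h1]; exact hy2
      · simp only [φ, Function.comp_apply]
        rw [h1, (extChartAt I q').right_inv hy1]
  have hinj : InjOn φ A := by
    rintro x ⟨hx1, hx2⟩ y ⟨hy1, hy2⟩ h
    exact (extChartAt I q).symm.injOn hx1 hy1 ((extChartAt I q').injOn (hq' hx2) (hq' hy2) h)
  have hφ : ∀ x ∈ A, HasFDerivWithinAt φ (fderiv ℝ φ x) A x := by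
    rintro x ⟨hx1, hx2⟩
    have h1 := contDiffWithinAt_transition (I := I) hx1 (hq' hx2)
    rw [I.range_eq_univ, contDiffWithinAt_univ] at h1
    exact (h1.differentiableAt (by norm_num)).hasFDerivAt.hasFDerivWithinAt
  rw [← himg, lintegral_image_eq_lintegral_abs_det_fderiv_mul _ hAm hφ hinj]
  refine setLIntegral_congr_fun hAm fun x hx => ?_
  rw [← ENNReal.ofReal_mul (abs_nonneg _), coordGram_det_transition g hx.1 (hq' hx.2),
    Real.sqrt_mul (sq_nonneg _), Real.sqrt_sq_eq_abs]

theorem chartMeasure_compl_source (g : RMetric I M) (q : M) :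
    chartMeasure g q (extChartAt I q).sourceᶜ = 0 := by
  rw [chartMeasure_apply g q (isOpen_extChartAt_source q).measurableSet.compl]
  have : (extChartAt I q).target ∩ (extChartAt I q).symm ⁻¹' (extChartAt I q).sourceᶜ = ∅ := by
    ext x
    simp only [mem_inter_iff, mem_preimage, mem_compl_iff, mem_empty_iff_false, iff_false,
      not_and, not_not]
    exact fun hx => (extChartAt I q).map_target hx
  rw [this]
  simp

/-- On a chart domain the Riemannian volume measure is the measure given by the density. -/
theorem volumeMeasure_apply_of_subset (g : RMetric I M) (q : M) {s : Set M} (hs : MeasurableSet s)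
    (hq : s ⊆ (extChartAt I q).source) : volumeMeasure g s = chartMeasure g q s := by
  have hle : ∀ q', chartMeasure g q' ≤ volumeMeasure g := fun q' => by
    unfold volumeMeasure
    exact le_iSup (fun q : M => chartMeasure g q) q'
  refine le_antisymm ?_ (hle q s)
  have hsrc : MeasurableSet (extChartAt I q).source := (isOpen_extChartAt_source q).measurableSet
  -- This comparison measure is infinite on every nonempty measurable set off the chart domain and
  -- agrees there with no particular chart. Inside the domain all chart measures agree on overlaps,
  -- so `m` bounds each of them and hence their supremum.
  let m : Measure M := chartMeasure g q + (⊤ : Measure M).restrict (extChartAt I q).sourceᶜ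
  have hm : volumeMeasure g ≤ m := by
    unfold volumeMeasure
    refine iSup_le fun q' => ?_
    change chartMeasure g q' ≤ m
    refine Measure.le_intro fun t ht _ => ?_
    have hsrc' : MeasurableSet (extChartAt I q').source :=
      (isOpen_extChartAt_source q').measurableSet
    calc chartMeasure g q' t
        ≤ chartMeasure g q' ((t ∩ (extChartAt I q).source ∩ (extChartAt I q').source) ∪
            (t ∩ (extChartAt I q).sourceᶜ) ∪ (extChartAt I q').sourceᶜ) := by
          refine measure_mono fun x hx => ?_
          by_cases h1 : x ∈ (extChartAt I q).source <;>
            by_cases h2 : x ∈ (extChartAt I q').source <;> simp_all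
      _ ≤ chartMeasure g q' (t ∩ (extChartAt I q).source ∩ (extChartAt I q').source) +
            chartMeasure g q' (t ∩ (extChartAt I q).sourceᶜ) + 0 := by
          rw [← chartMeasure_compl_source g q']
          exact (measure_union_le _ _).trans (add_le_add_left (measure_union_le _ _) _)
      _ ≤ chartMeasure g q t + (⊤ : Measure M) (t ∩ (extChartAt I q).sourceᶜ) := by
          rw [add_zero]
          refine add_le_add ?_ ?_
          · rw [chartMeasure_eq_of_subset g ((ht.inter hsrc).inter hsrc')
              (fun x hx => hx.1.2) (fun x hx => hx.2)]
            exact measure_mono fun x hx => hx.1.1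
          · exact (le_top : chartMeasure g q' ≤ ⊤) _
      _ = m t := by
          simp only [m, Measure.add_apply, Measure.restrict_apply ht]
  refine (hm s).trans ?_
  have h0 : s ∩ (extChartAt I q).sourceᶜ = ∅ := by
    rw [← sdiff_eq, sdiff_eq_empty.2 hq]
  simp only [m, Measure.add_apply, Measure.restrict_apply hs, h0, measure_empty, add_zero, le_refl]

theorem volumeMeasure_restrict_source (g : RMetric I M) (q : M) :
    (volumeMeasure g).restrict (extChartAt I q).source = chartMeasure g q := by
  have hsrc : MeasurableSet (extChartAt I q).source := (isOpen_extChartAt_source q).measurableSet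
  ext s hs
  rw [Measure.restrict_apply hs, volumeMeasure_apply_of_subset g q (hs.inter hsrc)
    inter_subset_right]
  refine le_antisymm (measure_mono inter_subset_left) ?_
  calc chartMeasure g q s
      ≤ chartMeasure g q ((s ∩ (extChartAt I q).source) ∪ (extChartAt I q).sourceᶜ) :=
        measure_mono fun x hx => by by_cases h : x ∈ (extChartAt I q).source <;> simp_all
    _ ≤ chartMeasure g q (s ∩ (extChartAt I q).source) + 0 := by
        rw [← chartMeasure_compl_source g q]; exact measure_union_le _ _
    _ = _ := add_zero _

/-- The integral of a function supported in a chart domain. -/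
theorem integral_volumeMeasure_eq (g : RMetric I M) (q : M) {F : M → ℝ} (hF : Continuous F)
    (hsupp : ∀ p, p ∉ (extChartAt I q).source → F p = 0) :
    ∫ p, F p ∂(volumeMeasure g) = ∫ x in (extChartAt I q).target,
      Real.sqrt (coordGram g q x).det * F ((extChartAt I q).symm x) := by
  rw [← setIntegral_eq_integral_of_forall_compl_eq_zero hsupp, volumeMeasure_restrict_source,
    chartMeasure, integral_map
      ((aemeasurable_extChartAt_symm q).mono_ac (withDensity_absolutelyContinuous _ _))
      hF.measurable.aestronglyMeasurable,
    integral_withDensity_eq_integral_toReal_smul₀ (aemeasurable_density g q)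
      (Filter.Eventually.of_forall fun _ => ENNReal.ofReal_lt_top)]
  simp only [ENNReal.toReal_ofReal (Real.sqrt_nonneg _), smul_eq_mul]

/-- Each point has a neighbourhood that corresponds to a subset of a closed ball inside the chart
target, where the density is continuous and hence integrable. Compactness turns local finiteness
into finiteness. -/
theorem isFiniteMeasure_volumeMeasure [CompactSpace M] (g : RMetric I M) :
    IsFiniteMeasure (volumeMeasure g) := by
  have hloc : IsLocallyFiniteMeasure (volumeMeasure g) := by
    refine ⟨fun q => ?_⟩
    obtain ⟨r, hr, hball⟩ := Metric.nhds_basis_closedBall.mem_iff.1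
      (extChartAt_target_mem_nhds (I := I) q)
    let U := (extChartAt I q).source ∩ extChartAt I q ⁻¹' ball (extChartAt I q q) r
    have hU : IsOpen U := isOpen_extChartAt_preimage' q isOpen_ball
    refine ⟨U, hU.mem_nhds ⟨mem_extChartAt_source q, mem_ball_self hr⟩, ?_⟩
    rw [volumeMeasure_apply_of_subset g q hU.measurableSet inter_subset_left,
      chartMeasure_apply g q hU.measurableSet]
    have hsub : (extChartAt I q).target ∩ (extChartAt I q).symm ⁻¹' U ⊆
        closedBall (extChartAt I q q) r := by
      rintro x ⟨hx1, hx2⟩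
      have h1 : extChartAt I q ((extChartAt I q).symm x) ∈ ball (extChartAt I q q) r := hx2.2
      rw [(extChartAt I q).right_inv hx1] at h1
      exact ball_subset_closedBall h1
    refine (lintegral_mono_set hsub).trans_lt ?_
    have hint : IntegrableOn (fun x => Real.sqrt (coordGram g q x).det)
        (closedBall (extChartAt I q q) r) :=
      (Real.continuous_sqrt.comp_continuousOn
        ((continuousOn_coordGram_det g q).mono hball)).integrableOn_compact
        (isCompact_closedBall _ _)
    exact hint.lintegral_lt_top
  exact ⟨isCompact_univ.measure_lt_top⟩

end Volume

end BrownYork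

/-! ### Surfaces in Euclidean space: Weingarten's and Gauss' formulas. -/

/-- A unit vector normal to an injective image of `ℝ²` in `ℝ³` spans, with this image, all of
`ℝ³`. -/
theorem exists_eq_add_smul_normal
    (L : EuclideanSpace ℝ (Fin 2) →L[ℝ] EuclideanSpace ℝ (Fin 3))
    (hL : ∀ u, u ≠ 0 → L u ≠ 0) {N : EuclideanSpace ℝ (Fin 3)} (hN : ‖N‖ = 1)
    (hNL : ∀ u, inner ℝ N (L u) = 0) (a : EuclideanSpace ℝ (Fin 3)) :
    ∃ u, a = L u + (inner ℝ N a : ℝ) • N := by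
  let Φ : EuclideanSpace ℝ (Fin 2) × ℝ →ₗ[ℝ] EuclideanSpace ℝ (Fin 3) :=
    LinearMap.coprod L.toLinearMap (LinearMap.toSpanSingleton ℝ _ N)
  have hΦ : ∀ u c, Φ (u, c) = L u + c • N := fun u c => by simp [Φ]
  have hNN : inner ℝ N N = (1 : ℝ) := by rw [real_inner_self_eq_norm_sq, hN, one_pow]
  have hc : ∀ u c, inner ℝ N (L u + c • N) = c := fun u c => by
    rw [inner_add_right, hNL, inner_smul_right, hNN, zero_add, mul_one]
  have hinj : Function.Injective Φ := by
    rw [← LinearMap.ker_eq_bot, LinearMap.ker_eq_bot']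
    rintro ⟨u, c⟩ h
    rw [hΦ] at h
    have h1 : c = 0 := by rw [← hc u c, h, inner_zero_right]
    rw [h1, zero_smul, add_zero] at h
    have h2 : u = 0 := by
      by_contra hu
      exact hL u hu h
    rw [h1, h2, Prod.mk_zero_zero]
  -- Injectivity gives surjectivity because `2 + 1 = 3`.
  have hsurj : Function.Surjective Φ :=
    (LinearMap.injective_iff_surjective_of_finrank_eq_finrank (by simp)).1 hinj
  obtain ⟨⟨u, c⟩, h⟩ := hsurj a
  rw [hΦ] at h
  refine ⟨u, ?_⟩
  rw [← h, hc]

namespace BrownYork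

section Euclidean

variable {S : Type*} [TopologicalSpace S] [ChartedSpace (EuclideanSpace ℝ (Fin 2)) S]
  [IsManifold (𝓡 2) ∞ S] {G : Type*} [NormedAddCommGroup G] [NormedSpace ℝ G]

theorem contDiffAt_inChart {φ : S → G} (hφ : ContMDiff (𝓡 2) 𝓘(ℝ, G) ∞ φ) {q : S}
    {x : EuclideanSpace ℝ (Fin 2)} (hx : x ∈ (extChartAt (𝓡 2) q).target) :
    ContDiffAt ℝ ∞ (φ ∘ (extChartAt (𝓡 2) q).symm) x := by
  rw [← contMDiffAt_iff_contDiffAt]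
  have h1 : ContMDiffAt (𝓡 2) (𝓡 2) ∞ (extChartAt (𝓡 2) q).symm x :=
    ((contMDiffOn_extChartAt_symm q) x hx).contMDiffAt (extChartAt_target_mem_nhds' hx)
  exact hφ.contMDiffAt.comp x h1

theorem mvfderiv_frame {φ : S → G} (hφ : ContMDiff (𝓡 2) 𝓘(ℝ, G) ∞ φ) {q : S}
    {x : EuclideanSpace ℝ (Fin 2)} (hx : x ∈ (extChartAt (𝓡 2) q).target)
    (u : EuclideanSpace ℝ (Fin 2)) :
    mvfderiv (𝓡 2) φ ((extChartAt (𝓡 2) q).symm x)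
      (mfderivWithin (𝓡 2) (𝓡 2) (extChartAt (𝓡 2) q).symm (range (𝓡 2)) x u) =
    fderiv ℝ (φ ∘ (extChartAt (𝓡 2) q).symm) x u := by
  have := isManifold_one_of_smooth (I := 𝓡 2) (M := S)
  have h := mfderiv_comp_mfderivWithin (I := 𝓡 2) (I' := 𝓡 2) (I'' := 𝓘(ℝ, G)) (g := φ)
    x (hφ.mdifferentiableAt (by norm_num)) (mdifferentiableWithinAt_extChartAt_symm hx)
    ((𝓡 2).uniqueMDiffOn _ (extChartAt_target_subset_range q hx))
  have h2 : mfderivWithin (𝓡 2) 𝓘(ℝ, G) (φ ∘ (extChartAt (𝓡 2) q).symm) (range (𝓡 2)) x =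
      fderiv ℝ (φ ∘ (extChartAt (𝓡 2) q).symm) x := by
    rw [mfderivWithin_eq_fderivWithin, modelWithCornersSelf_coe, range_id, fderivWithin_univ]
  exact (DFunLike.congr_fun (h.symm.trans h2) u)

omit [IsManifold (𝓡 2) ∞ S] in
theorem mvfderiv_eq_fderiv {φ : S → G} (hφ : ContMDiff (𝓡 2) 𝓘(ℝ, G) ∞ φ) (p : S)
    (u : EuclideanSpace ℝ (Fin 2)) :
    mvfderiv (𝓡 2) φ p u = fderiv ℝ (φ ∘ (extChartAt (𝓡 2) p).symm) (extChartAt (𝓡 2) p p) u := by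
  have h := (hφ.mdifferentiableAt (x := p) (by norm_num)).mvfderiv
  have h2 : fderivWithin ℝ (writtenInExtChartAt (𝓡 2) 𝓘(ℝ, G) p φ) (range (𝓡 2))
      (extChartAt (𝓡 2) p p) = fderiv ℝ (φ ∘ (extChartAt (𝓡 2) p).symm) (extChartAt (𝓡 2) p p) := by
    rw [modelWithCornersSelf_coe, range_id, fderivWithin_univ]
    rfl
  exact DFunLike.congr_fun (h.trans h2) u

variable {σ : RMetric (𝓡 2) S} {X N : S → EuclideanSpace ℝ (Fin 3)}

theorem IsEuclideanIsometricEmbedding.coordMetric_eq (hX : IsEuclideanIsometricEmbedding σ X)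
    {q : S} {x : EuclideanSpace ℝ (Fin 2)} (hx : x ∈ (extChartAt (𝓡 2) q).target)
    (u v : EuclideanSpace ℝ (Fin 2)) :
    coordMetric σ q x u v = inner ℝ (fderiv ℝ (X ∘ (extChartAt (𝓡 2) q).symm) x u)
      (fderiv ℝ (X ∘ (extChartAt (𝓡 2) q).symm) x v) := by
  rw [← mvfderiv_frame hX.contMDiff hx, ← mvfderiv_frame hX.contMDiff hx]
  exact (hX.isometric _ _ _).symm

theorem IsEuclideanIsometricEmbedding.fderiv_ne_zero (hX : IsEuclideanIsometricEmbedding σ X)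
    {q : S} {x : EuclideanSpace ℝ (Fin 2)} (hx : x ∈ (extChartAt (𝓡 2) q).target)
    (u : EuclideanSpace ℝ (Fin 2)) (hu : u ≠ 0) :
    fderiv ℝ (X ∘ (extChartAt (𝓡 2) q).symm) x u ≠ 0 := by
  intro h
  have h1 := coordMetric_self_pos σ hx hu
  rw [hX.coordMetric_eq hx, h, inner_zero_left] at h1
  exact lt_irrefl _ h1

theorem IsOutwardUnitNormal.inner_fderiv (hN : IsOutwardUnitNormal X N)
    (hX : IsEuclideanIsometricEmbedding σ X)
    {q : S} {x : EuclideanSpace ℝ (Fin 2)} (hx : x ∈ (extChartAt (𝓡 2) q).target)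
    (u : EuclideanSpace ℝ (Fin 2)) :
    inner ℝ (N ((extChartAt (𝓡 2) q).symm x)) (fderiv ℝ (X ∘ (extChartAt (𝓡 2) q).symm) x u) =
      0 := by
  rw [← mvfderiv_frame hX.contMDiff hx]
  exact hN.normal _ _

/-- Weingarten's equation in a chart. -/
theorem IsOutwardUnitNormal.inner_fderiv_fderiv (hN : IsOutwardUnitNormal X N)
    (hX : IsEuclideanIsometricEmbedding σ X)
    {q : S} {x : EuclideanSpace ℝ (Fin 2)} (hx : x ∈ (extChartAt (𝓡 2) q).target)
    (v w : EuclideanSpace ℝ (Fin 2)) :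
    inner ℝ (N ((extChartAt (𝓡 2) q).symm x))
      (fderiv ℝ (fun y => fderiv ℝ (X ∘ (extChartAt (𝓡 2) q).symm) y w) x v) =
    -inner ℝ (fderiv ℝ (N ∘ (extChartAt (𝓡 2) q).symm) x v)
      (fderiv ℝ (X ∘ (extChartAt (𝓡 2) q).symm) x w) := by
  have hXs : ContDiffAt ℝ 2 (X ∘ (extChartAt (𝓡 2) q).symm) x :=
    (contDiffAt_inChart hX.contMDiff hx).of_le (by norm_cast)
  have hNs : DifferentiableAt ℝ (N ∘ (extChartAt (𝓡 2) q).symm) x :=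
    (contDiffAt_inChart hN.contMDiff hx).differentiableAt (by norm_num)
  have h1 : DifferentiableAt ℝ (fun y => fderiv ℝ (X ∘ (extChartAt (𝓡 2) q).symm) y w) x :=
    ((hXs.fderiv_right (m := 1) (by norm_num)).differentiableAt (by norm_num)).clm_apply
      (differentiableAt_const w)
  -- The equation follows by differentiating the orthogonality of `N` and `dX w` near `x`.
  have h2 : (fun y => inner ℝ ((N ∘ (extChartAt (𝓡 2) q).symm) y)
      (fderiv ℝ (X ∘ (extChartAt (𝓡 2) q).symm) y w)) =ᶠ[nhds x] fun _ => (0 : ℝ) := by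
    filter_upwards [extChartAt_target_mem_nhds' hx] with y hy
    exact hN.inner_fderiv hX hy w
  have h3 := fderiv_inner_apply ℝ hNs h1 v
  rw [h2.fderiv_eq] at h3
  simp only [fderiv_fun_const, Pi.zero_apply, zero_apply, Function.comp_apply] at h3
  linarith

theorem euclideanSecondForm_eq (hN : IsOutwardUnitNormal X N)
    (hX : IsEuclideanIsometricEmbedding σ X) (p : S) (v w : TangentSpace (𝓡 2) p) :
    euclideanSecondForm X N p v w =
      inner ℝ (mvfderiv (𝓡 2) N p v) (mvfderiv (𝓡 2) X p w) := by
  have h := hN.inner_fderiv_fderiv hX (mem_extChartAt_target (I := 𝓡 2) p) v w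
  rw [extChartAt_to_inv] at h
  refine Eq.trans ?_ (congrArg₂ (inner ℝ) (mvfderiv_eq_fderiv hN.contMDiff p v).symm
    (mvfderiv_eq_fderiv hX.contMDiff p w).symm)
  unfold euclideanSecondForm
  rw [real_inner_comm]
  exact (congrArg Neg.neg h).trans (neg_neg _)

/-- The Christoffel symbols of the first kind of an isometrically embedded surface. -/
theorem IsEuclideanIsometricEmbedding.koszul_eq (hX : IsEuclideanIsometricEmbedding σ X)
    {q : S} {x : EuclideanSpace ℝ (Fin 2)} (hx : x ∈ (extChartAt (𝓡 2) q).target)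
    (u v w : EuclideanSpace ℝ (Fin 2)) :
    koszul σ q x u v w =
      inner ℝ (fderiv ℝ (fun y => fderiv ℝ (X ∘ (extChartAt (𝓡 2) q).symm) y v) x u)
        (fderiv ℝ (X ∘ (extChartAt (𝓡 2) q).symm) x w) := by
  set F := X ∘ (extChartAt (𝓡 2) q).symm with hF
  have hXs : ContDiffAt ℝ 2 F x := (contDiffAt_inChart hX.contMDiff hx).of_le (by norm_cast)
  have h1 : ∀ w, DifferentiableAt ℝ (fun y => fderiv ℝ F y w) x := fun w =>
    ((hXs.fderiv_right (m := 1) (by norm_num)).differentiableAt (by norm_num)).clm_apply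
      (differentiableAt_const w)
  have h2 : ∀ w u v, dCoordMetric σ q x w u v =
      inner ℝ (fderiv ℝ F x u) (fderiv ℝ (fderiv ℝ F) x w v)
        + inner ℝ (fderiv ℝ (fderiv ℝ F) x w u) (fderiv ℝ F x v) := by
    intro w u v
    have e1 : (fun y => coordMetric σ q y u v) =ᶠ[nhds x]
        fun y => inner ℝ (fderiv ℝ F y u) (fderiv ℝ F y v) := by
      filter_upwards [extChartAt_target_mem_nhds' hx] with y hy
      exact hX.coordMetric_eq hy u v
    unfold dCoordMetric
    rw [modelWithCornersSelf_coe, range_id, fderivWithin_univ, e1.fderiv_eq,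
      fderiv_inner_apply ℝ (h1 u) (h1 v), fderiv_fderiv_apply hXs, fderiv_fderiv_apply hXs]
  have hsymm := hXs.isSymmSndFDerivAt (by simp)
  unfold koszul
  rw [h2, h2, h2, fderiv_fderiv_apply hXs, hsymm.eq v u, hsymm.eq w u, hsymm.eq w v,
    real_inner_comm (fderiv ℝ F x v)]
  ring

variable {η : S → ℝ} {a : EuclideanSpace ℝ (Fin 3)} {a₀ : ℝ}

-- Only smoothness of `X` is assumed, so that the same lemma covers `⟨a, N⟩`, with `N` in the role
-- of `X`.
omit [IsManifold (𝓡 2) ∞ S] in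
theorem contMDiff_linear (hX : ContMDiff (𝓡 2) (𝓡 3) ∞ X)
    (hη : ∀ p, η p = a₀ + inner ℝ a (X p)) : ContMDiff (𝓡 2) 𝓘(ℝ, ℝ) ∞ η := by
  rw [show η = fun p => a₀ + inner ℝ a (X p) from funext hη]
  exact ((contDiff_const (c := a₀)).add ((contDiff_const (c := a)).inner ℝ
      (contDiff_id (𝕜 := ℝ) (E := EuclideanSpace ℝ (Fin 3)) (n := ∞)))).contMDiff.comp hX

theorem fderiv_linear (hX : ContMDiff (𝓡 2) (𝓡 3) ∞ X)
    (hη : ∀ p, η p = a₀ + inner ℝ a (X p)) {q : S} {x : EuclideanSpace ℝ (Fin 2)}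
    (hx : x ∈ (extChartAt (𝓡 2) q).target) (w : EuclideanSpace ℝ (Fin 2)) :
    fderiv ℝ (η ∘ (extChartAt (𝓡 2) q).symm) x w =
      inner ℝ a (fderiv ℝ (X ∘ (extChartAt (𝓡 2) q).symm) x w) := by
  have e1 : η ∘ (extChartAt (𝓡 2) q).symm =
      fun y => a₀ + inner ℝ a ((X ∘ (extChartAt (𝓡 2) q).symm) y) := funext fun y => hη _
  rw [e1, fderiv_const_add, fderiv_inner_apply ℝ (differentiableAt_const a)
    ((contDiffAt_inChart hX hx).differentiableAt (by norm_num))]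
  simp

/-- Gauss' formula: the Hessian of a linear function on a surface in `ℝ³`. -/
theorem hessian_linear (hN : IsOutwardUnitNormal X N) (hX : IsEuclideanIsometricEmbedding σ X)
    (hη : ∀ p, η p = a₀ + inner ℝ a (X p)) (p : S)
    (v w : EuclideanSpace ℝ (Fin 2)) :
    hessian σ η p v w = -(inner ℝ (N p) a * euclideanSecondForm X N p v w) := by
  set F := X ∘ (extChartAt (𝓡 2) p).symm with hF
  set x := extChartAt (𝓡 2) p p with hxdef
  have hx : x ∈ (extChartAt (𝓡 2) p).target := mem_extChartAt_target (I := 𝓡 2) p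
  have hXs : ContDiffAt ℝ 2 F x := (contDiffAt_inChart hX.contMDiff hx).of_le (by norm_cast)
  have hηs := contMDiff_linear hX.contMDiff hη
  have h1 : ∀ y ∈ (extChartAt (𝓡 2) p).target, ∀ w,
      fderiv ℝ (η ∘ (extChartAt (𝓡 2) p).symm) y w = inner ℝ a (fderiv ℝ F y w) :=
    fun y hy w => fderiv_linear hX.contMDiff hη hy w
  have h2 : DifferentiableAt ℝ (fun y => fderiv ℝ F y w) x :=
    ((hXs.fderiv_right (m := 1) (by norm_num)).differentiableAt (by norm_num)).clm_apply
      (differentiableAt_const _)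
  have h3 : fderiv ℝ (fun y => fderiv ℝ (η ∘ (extChartAt (𝓡 2) p).symm) y w) x v =
      inner ℝ a (fderiv ℝ (fun y => fderiv ℝ F y w) x v) := by
    have e1 : (fun y => fderiv ℝ (η ∘ (extChartAt (𝓡 2) p).symm) y w) =ᶠ[nhds x]
        fun y => inner ℝ a (fderiv ℝ F y w) := by
      filter_upwards [extChartAt_target_mem_nhds' hx] with y hy
      exact h1 y hy w
    rw [e1.fderiv_eq, fderiv_inner_apply ℝ (differentiableAt_const a) h2]
    simp
  set Γ := christoffel σ p x v w with hΓ
  have h4 : hessian σ η p v w =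
      inner ℝ a (fderiv ℝ (fun y => fderiv ℝ F y w) x v - fderiv ℝ F x Γ) := by
    rw [inner_sub_right, ← h3, ← h1 x hx,
      ← mvfderiv_eq_fderiv hηs]
    unfold hessian
    simp only [modelWithCornersSelf_coe, range_id, fderivWithin_univ]
    rfl
  -- Split `a` into its tangential part and its part along `N`. The vector `D²X(v, w) - dX(Γ)` is
  -- orthogonal to the first, since `Γ` is the Levi-Civita connection of the induced metric, and its
  -- product with `N` is `-II₀`.
  obtain ⟨T, hT⟩ := exists_eq_add_smul_normal (fderiv ℝ F x) (hX.fderiv_ne_zero hx) (hN.unit p)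
    (fun u => by have := hN.inner_fderiv hX hx u; rwa [extChartAt_to_inv] at this) a
  have h5 : inner ℝ (fderiv ℝ F x T)
      (fderiv ℝ (fun y => fderiv ℝ F y w) x v - fderiv ℝ F x Γ) = (0 : ℝ) := by
    have k1 : koszul σ p x v w T = inner ℝ (fderiv ℝ (fun y => fderiv ℝ F y w) x v)
        (fderiv ℝ F x T) := hX.koszul_eq hx v w T
    have k2 : coordMetric σ p x Γ T = inner ℝ (fderiv ℝ F x Γ) (fderiv ℝ F x T) :=
      hX.coordMetric_eq hx Γ T
    rw [inner_sub_right, real_inner_comm, ← k1, real_inner_comm, ← k2,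
      coordMetric_christoffel σ hx, sub_self]
  have h6 : inner ℝ (N p) (fderiv ℝ (fun y => fderiv ℝ F y w) x v - fderiv ℝ F x Γ) =
      -euclideanSecondForm X N p v w := by
    have := hN.inner_fderiv hX hx Γ
    rw [extChartAt_to_inv] at this
    rw [inner_sub_right, this, sub_zero, real_inner_comm]
    exact (neg_neg _).symm
  rw [h4]
  conv_lhs => rw [hT]
  rw [inner_add_left, h5, inner_smul_left, h6]
  simp

theorem laplacian_linear (hN : IsOutwardUnitNormal X N) (hX : IsEuclideanIsometricEmbedding σ X)
    (hη : ∀ p, η p = a₀ + inner ℝ a (X p)) (p : S) :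
    laplacian σ η p = -(inner ℝ (N p) a * euclideanMeanCurvature σ X N p) := by
  unfold laplacian euclideanMeanCurvature traceForm
  simp only [Finset.mul_sum, ← Finset.sum_neg_distrib]
  refine Finset.sum_congr rfl fun i _ => Finset.sum_congr rfl fun j _ => ?_
  have h := hessian_linear hN hX hη p (e i) (e j)
  linear_combination (gram σ p)⁻¹ i j * h

end Euclidean

end BrownYork

namespace BrownYork

/-! ### Gradients of linear functions. -/

section Gradient

variable {n : ℕ} {H : Type*} [TopologicalSpace H]
  {I : ModelWithCorners ℝ (EuclideanSpace ℝ (Fin n)) H}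
  {M : Type*} [TopologicalSpace M] [ChartedSpace H M] [IsManifold I ∞ M]

/-- This trades `dw(∇η)` for a metric trace, to which the chart formulas and continuity results for
traces apply; in the other direction it shows linearity in the first differential. -/
theorem traceForm_mul_mvfderiv (g : RMetric I M) (φ : M → ℝ) (q : M)
    (L : EuclideanSpace ℝ (Fin n) →ₗ[ℝ] ℝ) :
    traceForm g q (fun u v => L u * mvfderiv I φ q v) = L (grad g φ q) := by
  unfold grad traceForm
  refine Eq.trans ?_ (map_sum L _ _).symm
  refine Finset.sum_congr rfl fun i _ => ?_
  refine Eq.trans ?_ (map_smul L _ _).symm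
  rw [smul_eq_mul, Finset.sum_mul]
  exact Finset.sum_congr rfl fun j _ => by ring

/-- The gradient is the vector which represents the differential. -/
theorem grad_eq_of_inner (g : RMetric I M) (φ : M → ℝ) (q : M) (T : EuclideanSpace ℝ (Fin n))
    (hT : ∀ v : EuclideanSpace ℝ (Fin n), coordMetric g q (extChartAt I q q) T v =
      mvfderiv I φ q v) : grad g φ q = T := by
  have hx := mem_extChartAt_target (I := I) q
  have hc : ∀ i, (∑ j, (gram g q)⁻¹ i j * mvfderiv I φ q (e j : EuclideanSpace ℝ (Fin n))) =
      T i := by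
    intro i
    rw [gram_eq_coordGram]
    have h1 : ∀ j, mvfderiv I φ q (e j : EuclideanSpace ℝ (Fin n)) =
        ((coordGram g q (extChartAt I q q)).mulVec T) j := by
      intro j
      rw [← hT, coordMetric_symm, coordMetric_eq_sum]
      simp [Matrix.mulVec, dotProduct, mul_comm]
    simp only [h1]
    change ((coordGram g q (extChartAt I q q))⁻¹.mulVec
      ((coordGram g q (extChartAt I q q)).mulVec T)) i = T i
    rw [Matrix.mulVec_mulVec, Matrix.nonsing_inv_mul _
      (coordGram_posDef g hx).det_pos.ne'.isUnit, Matrix.one_mulVec]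
  unfold grad
  refine Eq.trans (Finset.sum_congr rfl fun i _ => congrArg (· • e i) (hc i)) ?_
  change (∑ i, T i • (e i : EuclideanSpace ℝ (Fin n))) = T
  ext k
  simp [Pi.single_apply]

end Gradient

section Bilinear

variable {S : Type*} [TopologicalSpace S] [ChartedSpace (EuclideanSpace ℝ (Fin 2)) S]
  [IsManifold (𝓡 2) ∞ S] {G G' : Type*} [NormedAddCommGroup G] [NormedSpace ℝ G]
  [NormedAddCommGroup G'] [NormedSpace ℝ G']

theorem traceForm_mvfderiv_chart (σ : RMetric (𝓡 2) S) (b : G →L[ℝ] G' →L[ℝ] ℝ)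
    {φ : S → G} (hφ : ContMDiff (𝓡 2) 𝓘(ℝ, G) ∞ φ)
    {ψ : S → G'} (hψ : ContMDiff (𝓡 2) 𝓘(ℝ, G') ∞ ψ) {q : S}
    {x : EuclideanSpace ℝ (Fin 2)} (hx : x ∈ (extChartAt (𝓡 2) q).target) :
    traceForm σ ((extChartAt (𝓡 2) q).symm x)
      (fun u v => b (mvfderiv (𝓡 2) φ _ u) (mvfderiv (𝓡 2) ψ _ v)) =
    ∑ i, ∑ j, (coordGram σ q x)⁻¹ i j *
      b (fderiv ℝ (φ ∘ (extChartAt (𝓡 2) q).symm) x (e i))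
        (fderiv ℝ (ψ ∘ (extChartAt (𝓡 2) q).symm) x (e j)) :=
  traceForm_chart σ hx _
    (b.toLinearMap₁₂.compl₁₂ (fderiv ℝ (φ ∘ (extChartAt (𝓡 2) q).symm) x).toLinearMap
      (fderiv ℝ (ψ ∘ (extChartAt (𝓡 2) q).symm) x).toLinearMap)
    fun v w => congrArg₂ (fun s t => b s t) (mvfderiv_frame hφ hx v) (mvfderiv_frame hψ hx w)

theorem continuous_traceForm_mvfderiv (σ : RMetric (𝓡 2) S) (b : G →L[ℝ] G' →L[ℝ] ℝ)
    {φ : S → G} (hφ : ContMDiff (𝓡 2) 𝓘(ℝ, G) ∞ φ)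
    {ψ : S → G'} (hψ : ContMDiff (𝓡 2) 𝓘(ℝ, G') ∞ ψ) :
    Continuous fun p => traceForm σ p
      (fun u v => b (mvfderiv (𝓡 2) φ p u) (mvfderiv (𝓡 2) ψ p v)) := by
  refine continuous_traceForm σ _ fun q => ⟨fun x =>
    b.toLinearMap₁₂.compl₁₂ (fderiv ℝ (φ ∘ (extChartAt (𝓡 2) q).symm) x).toLinearMap
      (fderiv ℝ (ψ ∘ (extChartAt (𝓡 2) q).symm) x).toLinearMap, fun i j => ?_, ?_⟩
  · have hq := mem_extChartAt_target (I := 𝓡 2) q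
    have h1 := ((contDiffAt_inChart hφ hq).continuousAt_fderiv (by norm_num)).clm_apply
      (continuousAt_const (y := (e i : EuclideanSpace ℝ (Fin 2))))
    have h2 := ((contDiffAt_inChart hψ hq).continuousAt_fderiv (by norm_num)).clm_apply
      (continuousAt_const (y := (e j : EuclideanSpace ℝ (Fin 2))))
    exact (b.continuous.continuousAt.comp h1).clm_apply h2
  · filter_upwards [extChartAt_target_mem_nhds (I := 𝓡 2) q] with x hx v w
    exact congrArg₂ (fun s t => b s t) (mvfderiv_frame hφ hx v) (mvfderiv_frame hψ hx w)

end Bilinear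

section Linear

variable {S : Type*} [TopologicalSpace S] [ChartedSpace (EuclideanSpace ℝ (Fin 2)) S]
  [IsManifold (𝓡 2) ∞ S] {σ : RMetric (𝓡 2) S} {X N : S → EuclideanSpace ℝ (Fin 3)}
  {η : S → ℝ} {a : EuclideanSpace ℝ (Fin 3)} {a₀ : ℝ}

theorem mvfderiv_linear (hX : ContMDiff (𝓡 2) (𝓡 3) ∞ X)
    (hη : ∀ p, η p = a₀ + inner ℝ a (X p)) (p : S) (v : EuclideanSpace ℝ (Fin 2)) :
    mvfderiv (𝓡 2) η p v = inner ℝ a (mvfderiv (𝓡 2) X p v) := by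
  refine (mvfderiv_eq_fderiv (contMDiff_linear hX hη) p v).trans ?_
  refine (fderiv_linear hX hη (mem_extChartAt_target (I := 𝓡 2) p) v).trans ?_
  exact congrArg (inner ℝ a) (mvfderiv_eq_fderiv hX p v).symm

/-- The differential of the embedding maps the gradient of a linear function to the tangential part
of its Euclidean gradient. -/
theorem mvfderiv_grad_linear (hN : IsOutwardUnitNormal X N)
    (hX : IsEuclideanIsometricEmbedding σ X) (hη : ∀ p, η p = a₀ + inner ℝ a (X p)) (p : S) :
    mvfderiv (𝓡 2) X p (grad σ η p) = a - (inner ℝ (N p) a : ℝ) • N p := by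
  have hx := mem_extChartAt_target (I := 𝓡 2) p
  obtain ⟨T, hT⟩ := exists_eq_add_smul_normal (fderiv ℝ (X ∘ (extChartAt (𝓡 2) p).symm)
    (extChartAt (𝓡 2) p p)) (hX.fderiv_ne_zero hx) (hN.unit p)
    (fun u => by have := hN.inner_fderiv hX hx u; rwa [extChartAt_to_inv] at this) a
  have hg : grad σ η p = T := by
    refine grad_eq_of_inner σ η p T fun v => ?_
    refine Eq.trans ?_ (mvfderiv_linear hX.contMDiff hη p v).symm
    refine Eq.trans ?_ (congrArg (inner ℝ a) (mvfderiv_eq_fderiv hX.contMDiff p v).symm)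
    rw [hX.coordMetric_eq hx]
    conv_rhs => rw [hT]
    have h := hN.inner_fderiv hX hx v
    rw [extChartAt_to_inv] at h
    rw [inner_add_left, inner_smul_left, h, mul_zero, add_zero]
  rw [hg]
  refine (mvfderiv_eq_fderiv hX.contMDiff p T).trans ?_
  exact eq_sub_of_add_eq hT.symm

/-- Pythagoras for the unit vector `a`, whose tangential part is `dX(∇η)`. -/
theorem inner_grad_linear (hN : IsOutwardUnitNormal X N)
    (hX : IsEuclideanIsometricEmbedding σ X) (ha : ‖a‖ = 1)
    (hη : ∀ p, η p = a₀ + inner ℝ a (X p)) (p : S) :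
    σ.inner p (grad σ η p) (grad σ η p) = 1 - inner ℝ (N p) a ^ 2 := by
  rw [← hX.isometric, mvfderiv_grad_linear hN hX hη]
  rw [inner_sub_left, inner_sub_right, inner_sub_right, inner_smul_left, inner_smul_left,
    inner_smul_right, inner_smul_right, real_inner_self_eq_norm_sq, real_inner_self_eq_norm_sq,
    ha, hN.unit, real_inner_comm (N p) a]
  simp only [conj_trivial]
  ring

theorem IsOutwardUnitNormal.inner_mvfderiv (hN : IsOutwardUnitNormal X N) (p : S)
    (v : EuclideanSpace ℝ (Fin 2)) : inner ℝ (mvfderiv (𝓡 2) N p v) (N p) = (0 : ℝ) := by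
  refine (congrArg (fun z => inner ℝ z (N p)) (mvfderiv_eq_fderiv hN.contMDiff p v)).trans ?_
  have hd := (contDiffAt_inChart hN.contMDiff
    (mem_extChartAt_target (I := 𝓡 2) p)).differentiableAt (by norm_num)
  have h2 := fderiv_inner_apply ℝ hd hd v
  have h3 : (fun x => inner ℝ ((N ∘ (extChartAt (𝓡 2) p).symm) x)
      ((N ∘ (extChartAt (𝓡 2) p).symm) x)) = fun _ => (1 : ℝ) := by
    funext x
    rw [real_inner_self_eq_norm_sq, Function.comp_apply, hN.unit, one_pow]
  rw [h3, real_inner_comm, Function.comp_apply, extChartAt_to_inv] at h2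
  simp only [fderiv_fun_const, Pi.zero_apply, zero_apply] at h2
  linarith

/-- With `dX(∇η) = a - ⟨N, a⟩ N` and `dN ⊥ N`, Weingarten's equation leaves `⟨dN(∇η), a⟩`, the
differential of `⟨a, N⟩` applied to `∇η`. -/
theorem secondForm_grad_linear (hN : IsOutwardUnitNormal X N)
    (hX : IsEuclideanIsometricEmbedding σ X)
    (hη : ∀ p, η p = a₀ + inner ℝ a (X p)) (p : S) :
    euclideanSecondForm X N p (grad σ η p) (grad σ η p) =
      traceForm σ p (fun u v => mvfderiv (𝓡 2) (fun p => (inner ℝ a (N p) : ℝ)) p u *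
        mvfderiv (𝓡 2) η p v) := by
  rw [euclideanSecondForm_eq hN hX, mvfderiv_grad_linear hN hX hη]
  have h1 : inner ℝ (mvfderiv (𝓡 2) N p (grad σ η p)) (N p) = (0 : ℝ) :=
    hN.inner_mvfderiv p _
  rw [inner_sub_right, inner_smul_right, h1, mul_zero, sub_zero]
  refine Eq.trans ?_ (traceForm_mul_mvfderiv σ η p
    (mvfderiv (𝓡 2) (fun p => (inner ℝ a (N p) : ℝ)) p).toLinearMap).symm
  rw [real_inner_comm]
  exact (mvfderiv_linear (a₀ := 0) hN.contMDiff (fun p => (zero_add _).symm) p _).symm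

end Linear

end BrownYork

/-! ### Conormal fields of a parametrized surface and their divergence. -/

section Conormal

variable {V : Type*} [NormedAddCommGroup V] [InnerProductSpace ℝ V]

/-- The squared area of the parallelogram spanned by two vectors. -/
def gramDet (a b : V) : ℝ := inner ℝ a a * inner ℝ b b - inner ℝ a b ^ 2

/-- The vector in the span of `a` and `b` which is orthogonal to `b`, and whose inner product with
`a` is the area of the parallelogram spanned by `a` and `b`. -/
noncomputable def conormal (a b : V) : V :=
  (Real.sqrt (gramDet a b))⁻¹ • ((inner ℝ b b : ℝ) • a - (inner ℝ a b : ℝ) • b)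

theorem gramDet_comm (a b : V) : gramDet a b = gramDet b a := by
  unfold gramDet
  rw [real_inner_comm a b]
  ring

theorem inner_conormal (a b c : V) : inner ℝ (conormal a b) c =
    (Real.sqrt (gramDet a b))⁻¹ * (inner ℝ b b * inner ℝ a c - inner ℝ a b * inner ℝ b c) := by
  unfold conormal
  rw [inner_smul_left, inner_sub_left, inner_smul_left, inner_smul_left]
  simp

theorem inner_conormal_left (a b : V) : inner ℝ (conormal a b) a = Real.sqrt (gramDet a b) := by
  rw [inner_conormal, real_inner_comm a b,
    show inner ℝ b b * inner ℝ a a - inner ℝ a b * inner ℝ a b = gramDet a b by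
      unfold gramDet; ring, ← div_eq_inv_mul, Real.div_sqrt]

theorem inner_conormal_right (a b : V) : inner ℝ (conormal a b) b = 0 := by
  rw [inner_conormal]
  ring

variable {W : Type*} [NormedAddCommGroup W] [NormedSpace ℝ W] {A B n : W → V} {x : W}

theorem contDiffAt_conormal {k : WithTop ℕ∞} (hA : ContDiffAt ℝ k A x) (hB : ContDiffAt ℝ k B x)
    (h : 0 < gramDet (A x) (B x)) : ContDiffAt ℝ k (fun y => conormal (A y) (B y)) x := by
  have hD : ContDiffAt ℝ k (fun y => gramDet (A y) (B y)) x :=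
    ((hA.inner ℝ hA).mul (hB.inner ℝ hB)).sub ((hA.inner ℝ hB).pow 2)
  exact ((hD.sqrt h.ne').inv (Real.sqrt_pos.2 h).ne').smul
    (((hB.inner ℝ hB).smul hA).sub ((hA.inner ℝ hB).smul hB))

/-- The divergence of the conormal fields of a parametrized surface is not tangential. -/
theorem inner_div_conormal_left (hA : ContDiffAt ℝ 1 A x) (hB : ContDiffAt ℝ 1 B x)
    (h : 0 < gramDet (A x) (B x)) {v w : W} (hAB : fderiv ℝ A x w = fderiv ℝ B x v) :
    inner ℝ (fderiv ℝ (fun y => conormal (A y) (B y)) x v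
      + fderiv ℝ (fun y => conormal (B y) (A y)) x w) (A x) = 0 := by
  have dA := hA.differentiableAt one_ne_zero
  have dB := hB.differentiableAt one_ne_zero
  have d1 := (contDiffAt_conormal hA hB h).differentiableAt one_ne_zero
  have d2 := (contDiffAt_conormal hB hA (by rwa [gramDet_comm])).differentiableAt one_ne_zero
  -- Let `c(A, B)` denote the conormal. Differentiate `⟨c(A, B), A⟩ = √D` along `v` and `⟨c(B, A),
  -- A⟩ = 0` along `w`. The terms cancel because the partial gradients of `√D` in `A` and `B` are
  -- the two conormals, and `∂_w A = ∂_v B`.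
  have e1 := fderiv_inner_apply ℝ d1 dA v
  have e2 := fderiv_inner_apply ℝ d2 dA w
  simp only [inner_conormal_left, inner_conormal_right] at e1 e2
  have dD : HasFDerivAt (fun y => gramDet (A y) (B y)) _ x :=
    ((dA.hasFDerivAt.inner ℝ dA.hasFDerivAt).mul (dB.hasFDerivAt.inner ℝ dB.hasFDerivAt)).sub
      ((dA.hasFDerivAt.inner ℝ dB.hasFDerivAt).pow 2)
  rw [(dD.sqrt h.ne').fderiv] at e1
  rw [add_comm, inner_add_left]
  simp only [fderiv_fun_const, Pi.zero_apply, zero_apply] at e2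
  rw [inner_conormal] at e1 e2
  rw [gramDet_comm (B x) (A x), hAB, real_inner_self_eq_norm_sq, real_inner_comm (A x) (B x)] at e2
  simp only [smul_apply, sub_apply, add_apply, ContinuousLinearMap.comp_apply,
    ContinuousLinearMap.prod_apply, fderivInnerCLM_apply, smul_eq_mul, nsmul_eq_mul,
    real_inner_self_eq_norm_sq, real_inner_comm (B x) (fderiv ℝ B x v),
    real_inner_comm (A x) (fderiv ℝ A x v), real_inner_comm (B x) (fderiv ℝ A x v)] at e1
  linear_combination -e1 - e2

/-- Conormals are tangential, so differentiating their vanishing product with `n` moves the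
derivative onto `n`. -/
theorem inner_div_conormal_normal (hA : ContDiffAt ℝ 1 A x) (hB : ContDiffAt ℝ 1 B x)
    (hn : DifferentiableAt ℝ n x) (h : 0 < gramDet (A x) (B x))
    (hnA : ∀ᶠ y in nhds x, inner ℝ (n y) (A y) = 0)
    (hnB : ∀ᶠ y in nhds x, inner ℝ (n y) (B y) = 0) (v : W) :
    inner ℝ (fderiv ℝ (fun y => conormal (A y) (B y)) x v) (n x) =
      -inner ℝ (conormal (A x) (B x)) (fderiv ℝ n x v) := by
  have d1 := (contDiffAt_conormal hA hB h).differentiableAt one_ne_zero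
  have e1 := fderiv_inner_apply ℝ d1 hn v
  have e2 : (fun y => inner ℝ (conormal (A y) (B y)) (n y)) =ᶠ[nhds x] fun _ => (0 : ℝ) := by
    filter_upwards [hnA, hnB] with y h1 h2
    rw [inner_conormal, real_inner_comm (n y) (A y), h1, real_inner_comm (n y) (B y), h2]
    ring
  rw [e2.fderiv_eq] at e1
  simp only [fderiv_fun_const, Pi.zero_apply, zero_apply] at e1
  linarith

/-- The divergence of the conormal fields of a parametrized surface is the area density times the
mean curvature vector. -/
theorem inner_div_conormal (hA : ContDiffAt ℝ 1 A x) (hB : ContDiffAt ℝ 1 B x)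
    (hn : DifferentiableAt ℝ n x) (h : 0 < gramDet (A x) (B x))
    (hnA : ∀ᶠ y in nhds x, inner ℝ (n y) (A y) = 0)
    (hnB : ∀ᶠ y in nhds x, inner ℝ (n y) (B y) = 0)
    {v w : W} (hAB : fderiv ℝ A x w = fderiv ℝ B x v) {a : V} {α β c : ℝ}
    (ha : a = α • A x + β • B x + c • n x) :
    inner ℝ a (fderiv ℝ (fun y => conormal (A y) (B y)) x v
      + fderiv ℝ (fun y => conormal (B y) (A y)) x w) =
    -c * (inner ℝ (conormal (A x) (B x)) (fderiv ℝ n x v) +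
      inner ℝ (conormal (B x) (A x)) (fderiv ℝ n x w)) := by
  have h' : 0 < gramDet (B x) (A x) := by rwa [gramDet_comm]
  have e1 := inner_div_conormal_left hA hB h hAB
  have e2 := inner_div_conormal_left hB hA h' hAB.symm
  have e3 := inner_div_conormal_normal hA hB hn h hnA hnB v
  have e4 := inner_div_conormal_normal hB hA hn h' hnB hnA w
  rw [add_comm] at e2
  rw [real_inner_comm, ha, inner_add_right, inner_add_right, inner_smul_right, inner_smul_right,
    inner_smul_right, e1, e2, inner_add_left, e3, e4]
  ring

end Conormal

/-- Cramer's rule with `√d · d⁻¹ = (√d)⁻¹`. No condition on the determinant is needed: for `d ≤ 0`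
the conventions make both sides zero. -/
theorem Matrix.sqrt_det_mul_sum_inv (A : Matrix (Fin 2) (Fin 2) ℝ)
    (T : Fin 2 → Fin 2 → ℝ) :
    Real.sqrt A.det * ∑ i, ∑ j, A⁻¹ i j * T i j = (Real.sqrt A.det)⁻¹ *
      (A 1 1 * T 0 0 - A 0 1 * T 0 1 - A 1 0 * T 1 0 + A 0 0 * T 1 1) := by
  have h1 : (Real.sqrt A.det)⁻¹ = Real.sqrt A.det * A.det⁻¹ := by
    rw [← div_eq_mul_inv, Real.sqrt_div_self', one_div]
  rw [h1, Matrix.inv_def, Ring.inverse_eq_inv', Matrix.adjugate_fin_two]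
  simp [Fin.sum_univ_two]
  ring

/-! ### Integrals of derivatives of compactly supported functions. -/

section Euclidean

variable {E : Type*} [NormedAddCommGroup E] [NormedSpace ℝ E] [FiniteDimensional ℝ E]
  [MeasurableSpace E] [BorelSpace E] (μ : Measure E) [μ.IsAddHaarMeasure] {P : E → ℝ}

omit [FiniteDimensional ℝ E] in
theorem integrable_fderiv_apply (hP : ContDiff ℝ 1 P) (hc : HasCompactSupport P) (v : E) :
    Integrable (fun x => fderiv ℝ P x v) μ :=
  ((hP.continuous_fderiv one_ne_zero).clm_apply continuous_const).integrable_of_hasCompactSupport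
    (hc.fderiv_apply ℝ v)

/-- Integration by parts against the constant function `1`. -/
theorem integral_fderiv_eq_zero (hP : ContDiff ℝ 1 P) (hc : HasCompactSupport P) (v : E) :
    ∫ x, fderiv ℝ P x v ∂μ = 0 := by
  have h := integral_mul_fderiv_eq_neg_fderiv_mul_of_integrable (μ := μ) (f := fun _ => (1 : ℝ))
    (g := P) (v := v) (by simp) (by simpa using integrable_fderiv_apply μ hP hc v)
    (by simpa using hP.continuous.integrable_of_hasCompactSupport hc)
    (fun x _ => differentiableAt_const _)
    (fun x _ => hP.differentiable one_ne_zero x)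
  simpa using h

end Euclidean

/-- The open sets `U` and `Kᶜ` cover the space; the extension by zero is `f` on the first and `0` on
the second. -/
theorem contDiff_indicator_of_compact {E G : Type*} [NormedAddCommGroup E] [NormedSpace ℝ E]
    [NormedAddCommGroup G] [NormedSpace ℝ G] {k : WithTop ℕ∞} {U K : Set E} (hU : IsOpen U)
    (hK : IsCompact K) (hKU : K ⊆ U) {f : E → G} (hf : ∀ x ∈ U, ContDiffAt ℝ k f x)
    (h0 : ∀ x ∈ U, x ∉ K → f x = 0) :
    ContDiff ℝ k (U.indicator f) ∧ tsupport (U.indicator f) ⊆ K := by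
  have hz : ∀ x, x ∉ K → U.indicator f x = 0 := fun x hx => by
    by_cases hxU : x ∈ U
    · rw [indicator_of_mem hxU, h0 x hxU hx]
    · exact indicator_of_notMem hxU f
  refine ⟨contDiff_iff_contDiffAt.2 fun x => ?_, closure_minimal
    (fun x hx => by_contra fun h => hx (hz x h)) hK.isClosed⟩
  by_cases hx : x ∈ U
  · refine (hf x hx).congr_of_eventuallyEq ?_
    filter_upwards [hU.mem_nhds hx] with y hy using indicator_of_mem hy f
  · refine (contDiffAt_const (c := (0 : G))).congr_of_eventuallyEq ?_
    filter_upwards [hK.isClosed.isOpen_compl.mem_nhds (fun h => hx (hKU h))] with y hy using hz y hy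

namespace BrownYork

/-! ### The divergence theorem inside one chart. -/

section Divergence

variable {S : Type*} [TopologicalSpace S] [ChartedSpace (EuclideanSpace ℝ (Fin 2)) S]
  [IsManifold (𝓡 2) ∞ S] {σ : RMetric (𝓡 2) S} {X N : S → EuclideanSpace ℝ (Fin 3)}
  {η u : S → ℝ} {a : EuclideanSpace ℝ (Fin 3)} {a₀ : ℝ}

/-- The coordinate vector fields of a surface in `ℝ³`. -/
noncomputable def coordField (X : S → EuclideanSpace ℝ (Fin 3)) (q : S) (i : Fin 2)
    (x : EuclideanSpace ℝ (Fin 2)) : EuclideanSpace ℝ (Fin 3) :=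
  fderiv ℝ (X ∘ (extChartAt (𝓡 2) q).symm) x (e i)

theorem contDiffAt_coordField (hX : ContMDiff (𝓡 2) (𝓡 3) ∞ X) {q : S}
    {x : EuclideanSpace ℝ (Fin 2)} (hx : x ∈ (extChartAt (𝓡 2) q).target) (i : Fin 2) :
    ContDiffAt ℝ 1 (coordField X q i) x :=
  ((contDiffAt_inChart hX hx).fderiv_right (m := 1) (by norm_cast)).clm_apply contDiffAt_const

theorem fderiv_coordField_comm (hX : ContMDiff (𝓡 2) (𝓡 3) ∞ X) {q : S}
    {x : EuclideanSpace ℝ (Fin 2)} (hx : x ∈ (extChartAt (𝓡 2) q).target) (i j : Fin 2) :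
    fderiv ℝ (coordField X q i) x (e j) = fderiv ℝ (coordField X q j) x (e i) := by
  have hXs : ContDiffAt ℝ 2 (X ∘ (extChartAt (𝓡 2) q).symm) x :=
    (contDiffAt_inChart hX hx).of_le (by norm_cast)
  unfold coordField
  rw [fderiv_fderiv_apply hXs, fderiv_fderiv_apply hXs]
  exact (hXs.isSymmSndFDerivAt (by simp)).eq _ _

theorem coordGram_eq_inner (hX : IsEuclideanIsometricEmbedding σ X) {q : S}
    {x : EuclideanSpace ℝ (Fin 2)} (hx : x ∈ (extChartAt (𝓡 2) q).target) (i j : Fin 2) :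
    coordGram σ q x i j = inner ℝ (coordField X q i x) (coordField X q j x) :=
  hX.coordMetric_eq hx _ _

theorem gramDet_coordField (hX : IsEuclideanIsometricEmbedding σ X) {q : S}
    {x : EuclideanSpace ℝ (Fin 2)} (hx : x ∈ (extChartAt (𝓡 2) q).target) :
    gramDet (coordField X q 0 x) (coordField X q 1 x) = (coordGram σ q x).det := by
  rw [Matrix.det_fin_two, coordGram_eq_inner hX hx, coordGram_eq_inner hX hx,
    coordGram_eq_inner hX hx, coordGram_eq_inner hX hx, gramDet,
    real_inner_comm (coordField X q 0 x) (coordField X q 1 x), sq]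

/-- The conormal fields express traces. -/
theorem sqrt_det_mul_trace (hX : IsEuclideanIsometricEmbedding σ X) {q : S}
    {x : EuclideanSpace ℝ (Fin 2)} (hx : x ∈ (extChartAt (𝓡 2) q).target)
    (z : Fin 2 → EuclideanSpace ℝ (Fin 3)) :
    Real.sqrt (coordGram σ q x).det *
      ∑ i, ∑ j, (coordGram σ q x)⁻¹ i j * inner ℝ (z i) (coordField X q j x) =
    inner ℝ (conormal (coordField X q 0 x) (coordField X q 1 x)) (z 0) +
      inner ℝ (conormal (coordField X q 1 x) (coordField X q 0 x)) (z 1) := by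
  rw [Matrix.sqrt_det_mul_sum_inv, inner_conormal, inner_conormal,
    gramDet_comm (coordField X q 1 x), gramDet_coordField hX hx]
  simp only [coordGram_eq_inner hX hx, real_inner_comm (coordField X q _ x) (z _)]
  ring

theorem sqrt_det_mul_meanCurvature (hN : IsOutwardUnitNormal X N)
    (hX : IsEuclideanIsometricEmbedding σ X) {q : S}
    {x : EuclideanSpace ℝ (Fin 2)} (hx : x ∈ (extChartAt (𝓡 2) q).target) :
    Real.sqrt (coordGram σ q x).det *
      euclideanMeanCurvature σ X N ((extChartAt (𝓡 2) q).symm x) =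
    inner ℝ (conormal (coordField X q 0 x) (coordField X q 1 x)) (coordField N q 0 x) +
      inner ℝ (conormal (coordField X q 1 x) (coordField X q 0 x)) (coordField N q 1 x) := by
  rw [← sqrt_det_mul_trace hX hx fun i => coordField N q i x]
  congr 1
  unfold euclideanMeanCurvature
  rw [show euclideanSecondForm X N ((extChartAt (𝓡 2) q).symm x) = _ from
    funext fun v => funext fun w => euclideanSecondForm_eq hN hX _ v w]
  exact traceForm_mvfderiv_chart σ (innerSL ℝ) hN.contMDiff hX.contMDiff hx

theorem sqrt_det_mul_trace_linear (hX : IsEuclideanIsometricEmbedding σ X)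
    (hη : ∀ p, η p = a₀ + inner ℝ a (X p)) (hu : ContMDiff (𝓡 2) 𝓘(ℝ, ℝ) ∞ u) {q : S}
    {x : EuclideanSpace ℝ (Fin 2)} (hx : x ∈ (extChartAt (𝓡 2) q).target) :
    Real.sqrt (coordGram σ q x).det * traceForm σ ((extChartAt (𝓡 2) q).symm x)
      (fun v w => mvfderiv (𝓡 2) u _ v * mvfderiv (𝓡 2) η _ w) =
    fderiv ℝ (u ∘ (extChartAt (𝓡 2) q).symm) x (e 0) *
        inner ℝ a (conormal (coordField X q 0 x) (coordField X q 1 x)) +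
      fderiv ℝ (u ∘ (extChartAt (𝓡 2) q).symm) x (e 1) *
        inner ℝ a (conormal (coordField X q 1 x) (coordField X q 0 x)) := by
  refine (congrArg (Real.sqrt (coordGram σ q x).det * ·) (traceForm_mvfderiv_chart σ
    (ContinuousLinearMap.mul ℝ ℝ) hu (contMDiff_linear hX.contMDiff hη) hx)).trans ?_
  have h := sqrt_det_mul_trace hX hx
    fun i => fderiv ℝ (u ∘ (extChartAt (𝓡 2) q).symm) x (e i) • a
  simp only [inner_smul_left, inner_smul_right, conj_trivial] at h
  rw [real_inner_comm a, real_inner_comm a] at h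
  refine Eq.trans ?_ h
  simp only [ContinuousLinearMap.mul_apply', fderiv_linear hX.contMDiff hη hx]
  rfl

/-- The tangential part of a constant vector field has divergence `-⟨N, a⟩ H₀`. -/
theorem inner_div_conormal_coordField (hN : IsOutwardUnitNormal X N)
    (hX : IsEuclideanIsometricEmbedding σ X) {q : S}
    {x : EuclideanSpace ℝ (Fin 2)} (hx : x ∈ (extChartAt (𝓡 2) q).target)
    (a : EuclideanSpace ℝ (Fin 3)) :
    inner ℝ a (fderiv ℝ (fun y => conormal (coordField X q 0 y) (coordField X q 1 y)) x (e 0) +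
      fderiv ℝ (fun y => conormal (coordField X q 1 y) (coordField X q 0 y)) x (e 1)) =
    -(inner ℝ (N ((extChartAt (𝓡 2) q).symm x)) a) * (Real.sqrt (coordGram σ q x).det *
      euclideanMeanCurvature σ X N ((extChartAt (𝓡 2) q).symm x)) := by
  rw [sqrt_det_mul_meanCurvature hN hX hx]
  have hNA : ∀ i, ∀ᶠ y in nhds x,
      inner ℝ ((N ∘ (extChartAt (𝓡 2) q).symm) y) (coordField X q i y) = 0 := fun i => by
    filter_upwards [extChartAt_target_mem_nhds' hx] with y hy using hN.inner_fderiv hX hy (e i)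
  obtain ⟨T, hT⟩ := exists_eq_add_smul_normal (fderiv ℝ (X ∘ (extChartAt (𝓡 2) q).symm) x)
    (hX.fderiv_ne_zero hx) (hN.unit _) (hN.inner_fderiv hX hx) a
  have hT2 : T = T 0 • (e 0 : EuclideanSpace ℝ (Fin 2)) + T 1 • (e 1) := by
    ext k
    fin_cases k <;> simp
  refine inner_div_conormal (α := T 0) (β := T 1) (n := N ∘ (extChartAt (𝓡 2) q).symm)
    (contDiffAt_coordField hX.contMDiff hx 0)
    (contDiffAt_coordField hX.contMDiff hx 1)
    ((contDiffAt_inChart hN.contMDiff hx).differentiableAt (by norm_num))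
    ?_ (hNA 0) (hNA 1) (fderiv_coordField_comm hX.contMDiff hx 0 1) ?_
  · rw [gramDet_coordField hX hx]
    exact (coordGram_posDef σ hx).det_pos
  · conv_lhs => rw [hT]
    rw [hT2, map_add, map_smul, map_smul]
    simp [coordField]

variable [CompactSpace S] [MeasurableSpace S] [BorelSpace S]

/-- The divergence theorem for a linear function on a surface in `ℝ³`, tested against a function
supported in a chart domain. -/
theorem integral_trace_linear_of_tsupport_subset (hN : IsOutwardUnitNormal X N)
    (hX : IsEuclideanIsometricEmbedding σ X)
    (hη : ∀ p, η p = a₀ + inner ℝ a (X p)) (hu : ContMDiff (𝓡 2) 𝓘(ℝ, ℝ) ∞ u) {q : S}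
    (huq : tsupport u ⊆ (extChartAt (𝓡 2) q).source)
    (hc : Continuous fun p => traceForm σ p
        (fun v w => mvfderiv (𝓡 2) u p v * mvfderiv (𝓡 2) η p w) -
      u p * (inner ℝ (N p) a * euclideanMeanCurvature σ X N p)) :
    ∫ p, (traceForm σ p (fun v w => mvfderiv (𝓡 2) u p v * mvfderiv (𝓡 2) η p w) -
      u p * (inner ℝ (N p) a * euclideanMeanCurvature σ X N p)) ∂(volumeMeasure σ) = 0 := by
  let χ := extChartAt (𝓡 2) q
  -- `P` and `Q` are the two coordinate components of `√det g · u ∇η`: the products of `a` with the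
  -- conormals are those of `√det g · ∇η`.
  let P : EuclideanSpace ℝ (Fin 2) → ℝ := fun y => (u ∘ χ.symm) y *
    inner ℝ a (conormal (coordField X q 0 y) (coordField X q 1 y))
  let Q : EuclideanSpace ℝ (Fin 2) → ℝ := fun y => (u ∘ χ.symm) y *
    inner ℝ a (conormal (coordField X q 1 y) (coordField X q 0 y))
  have hopen : IsOpen χ.target := isOpen_extChartAt_target q
  have hK : IsCompact (χ '' tsupport u) := (isClosed_tsupport u).isCompact.image_of_continuousOn
    ((continuousOn_extChartAt q).mono huq)
  have hKU : χ '' tsupport u ⊆ χ.target := by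
    rintro _ ⟨p, hp, rfl⟩
    exact χ.map_source (huq hp)
  have hu0 : ∀ x ∈ χ.target, x ∉ χ '' tsupport u → (u ∘ χ.symm) x = 0 := fun x hx hxK => by
    by_contra h
    exact hxK ⟨χ.symm x, subset_tsupport u h, χ.right_inv hx⟩
  have hgram : ∀ x ∈ χ.target, 0 < gramDet (coordField X q 0 x) (coordField X q 1 x) :=
    fun x hx => by
      rw [gramDet_coordField hX hx]
      exact (coordGram_posDef σ hx).det_pos
  have hV1 : ∀ x ∈ χ.target, ContDiffAt ℝ 1
      (fun y => conormal (coordField X q 0 y) (coordField X q 1 y)) x := fun x hx =>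
    contDiffAt_conormal (contDiffAt_coordField hX.contMDiff hx 0)
      (contDiffAt_coordField hX.contMDiff hx 1) (hgram x hx)
  have hV2 : ∀ x ∈ χ.target, ContDiffAt ℝ 1
      (fun y => conormal (coordField X q 1 y) (coordField X q 0 y)) x := fun x hx =>
    contDiffAt_conormal (contDiffAt_coordField hX.contMDiff hx 1)
      (contDiffAt_coordField hX.contMDiff hx 0) (by rw [gramDet_comm]; exact hgram x hx)
  have hu1 : ∀ x ∈ χ.target, ContDiffAt ℝ 1 (u ∘ χ.symm) x := fun x hx =>
    (contDiffAt_inChart hu hx).of_le (by norm_cast)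
  have hP := contDiff_indicator_of_compact (f := P) hopen hK hKU
    (fun x hx => (hu1 x hx).mul (contDiffAt_const.inner ℝ (hV1 x hx)))
    (fun x hx hxK => by simp only [P, hu0 x hx hxK, zero_mul])
  have hQ := contDiff_indicator_of_compact (f := Q) hopen hK hKU
    (fun x hx => (hu1 x hx).mul (contDiffAt_const.inner ℝ (hV2 x hx)))
    (fun x hx hxK => by simp only [Q, hu0 x hx hxK, zero_mul])
  have hPc := hK.of_isClosed_subset (isClosed_tsupport _) hP.2
  have hQc := hK.of_isClosed_subset (isClosed_tsupport _) hQ.2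
  rw [integral_volumeMeasure_eq σ q hc ?_]
  -- By the product rule the derivatives of `u` give the trace term, and the derivatives of the
  -- conormals give `-u ⟨N, a⟩ H₀`.
  · have key : ∀ x ∈ χ.target, Real.sqrt (coordGram σ q x).det *
        (traceForm σ (χ.symm x) (fun v w => mvfderiv (𝓡 2) u _ v * mvfderiv (𝓡 2) η _ w) -
          u (χ.symm x) * (inner ℝ (N (χ.symm x)) a * euclideanMeanCurvature σ X N (χ.symm x))) =
        fderiv ℝ (χ.target.indicator P) x (e 0) + fderiv ℝ (χ.target.indicator Q) x (e 1) := by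
      intro x hx
      have e1 : χ.target.indicator P =ᶠ[nhds x] P := by
        filter_upwards [hopen.mem_nhds hx] with y hy using indicator_of_mem hy P
      have e2 : χ.target.indicator Q =ᶠ[nhds x] Q := by
        filter_upwards [hopen.mem_nhds hx] with y hy using indicator_of_mem hy Q
      have du := (hu1 x hx).differentiableAt one_ne_zero
      have d1 := (hV1 x hx).differentiableAt one_ne_zero
      have d2 := (hV2 x hx).differentiableAt one_ne_zero
      rw [e1.fderiv_eq, e2.fderiv_eq,
        fderiv_fun_mul du ((differentiableAt_const a).inner ℝ d1),
        fderiv_fun_mul du ((differentiableAt_const a).inner ℝ d2)]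
      simp only [add_apply, smul_apply, smul_eq_mul,
        fderiv_inner_apply ℝ (differentiableAt_const a) d1,
        fderiv_inner_apply ℝ (differentiableAt_const a) d2, fderiv_fun_const, Pi.zero_apply,
        zero_apply, inner_zero_left, add_zero, Function.comp_apply]
      have h1 := sqrt_det_mul_trace_linear hX hη hu hx
      have h2 := inner_div_conormal_coordField hN hX hx a
      rw [inner_add_right] at h2
      rw [mul_sub, h1]
      linear_combination (-u (χ.symm x)) * h2
    rw [setIntegral_congr_fun hopen.measurableSet key,
      setIntegral_eq_integral_of_forall_compl_eq_zero fun x hx => ?_,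
      integral_add (integrable_fderiv_apply _ hP.1 hPc _) (integrable_fderiv_apply _ hQ.1 hQc _),
      integral_fderiv_eq_zero _ hP.1 hPc, integral_fderiv_eq_zero _ hQ.1 hQc, add_zero]
    rw [fderiv_of_notMem_tsupport ℝ fun h => hx (hKU (hP.2 h)),
      fderiv_of_notMem_tsupport ℝ fun h => hx (hKU (hQ.2 h)), zero_apply, zero_apply, add_zero]
  · intro p hp
    -- Off the support `u` vanishes in a whole neighbourhood, so its differential vanishes along
    -- with its value.
    have hpt : p ∉ tsupport u := fun h => hp (huq h)
    have hd : ∀ v : EuclideanSpace ℝ (Fin 2), mvfderiv (𝓡 2) u p v = 0 := fun v => by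
      refine (mvfderiv_eq_fderiv hu p v).trans ?_
      have h0 : u ∘ (extChartAt (𝓡 2) p).symm =ᶠ[nhds (extChartAt (𝓡 2) p p)] fun _ => 0 := by
        have h1 := continuousAt_extChartAt_symm (I := 𝓡 2) p
        rw [ContinuousAt, extChartAt_to_inv] at h1
        exact h1.eventually (notMem_tsupport_iff_eventuallyEq.1 hpt)
      rw [h0.fderiv_eq, fderiv_fun_const]
      rfl
    rw [image_eq_zero_of_notMem_tsupport hpt, zero_mul, sub_zero]
    exact (traceForm_mul_mvfderiv σ η p (mvfderiv (𝓡 2) u p).toLinearMap).trans (hd _)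

end Divergence

end BrownYork

namespace BrownYork

/-! ### The global divergence theorem. -/

section Green

variable {S : Type*} [TopologicalSpace S] [ChartedSpace (EuclideanSpace ℝ (Fin 2)) S]
  [IsManifold (𝓡 2) ∞ S] {σ : RMetric (𝓡 2) S} {X N : S → EuclideanSpace ℝ (Fin 3)}
  {η u : S → ℝ} {a : EuclideanSpace ℝ (Fin 3)} {a₀ : ℝ}

theorem continuous_euclideanMeanCurvature (hN : IsOutwardUnitNormal X N)
    (hX : IsEuclideanIsometricEmbedding σ X) : Continuous (euclideanMeanCurvature σ X N) := by
  have h := continuous_traceForm_mvfderiv σ (innerSL ℝ) hN.contMDiff hX.contMDiff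
  refine h.congr fun p => ?_
  exact congrArg (traceForm σ p)
    (funext fun v => funext fun w => (euclideanSecondForm_eq hN hX p v w).symm)

theorem continuous_traceForm_mul (σ : RMetric (𝓡 2) S) (hu : ContMDiff (𝓡 2) 𝓘(ℝ, ℝ) ∞ u)
    (hη : ContMDiff (𝓡 2) 𝓘(ℝ, ℝ) ∞ η) :
    Continuous fun p => traceForm σ p
      (fun v w => mvfderiv (𝓡 2) u p v * mvfderiv (𝓡 2) η p w) :=
  continuous_traceForm_mvfderiv σ (ContinuousLinearMap.mul ℝ ℝ) hu hη

variable [CompactSpace S] [MeasurableSpace S] [BorelSpace S]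

theorem integrable_of_continuous (σ : RMetric (𝓡 2) S) {F : S → ℝ} (hF : Continuous F) :
    Integrable F (volumeMeasure σ) := by
  have := isFiniteMeasure_volumeMeasure σ
  exact hF.integrable_of_hasCompactSupport (HasCompactSupport.of_compactSpace F)

/-- The divergence theorem for a linear function on a closed surface in `ℝ³`. -/
theorem integral_trace_linear [T2Space S] (hN : IsOutwardUnitNormal X N)
    (hX : IsEuclideanIsometricEmbedding σ X)
    (hη : ∀ p, η p = a₀ + inner ℝ a (X p)) (hu : ContMDiff (𝓡 2) 𝓘(ℝ, ℝ) ∞ u) :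
    ∫ p, (traceForm σ p (fun v w => mvfderiv (𝓡 2) u p v * mvfderiv (𝓡 2) η p w) -
      u p * (inner ℝ (N p) a * euclideanMeanCurvature σ X N p)) ∂(volumeMeasure σ) = 0 := by
  have hηs := contMDiff_linear hX.contMDiff hη
  have hcont : ∀ u : S → ℝ, ContMDiff (𝓡 2) 𝓘(ℝ, ℝ) ∞ u → Continuous fun p => traceForm σ p
      (fun v w => mvfderiv (𝓡 2) u p v * mvfderiv (𝓡 2) η p w) -
      u p * (inner ℝ (N p) a * euclideanMeanCurvature σ X N p) := fun u hu =>
    (continuous_traceForm_mul σ hu hηs).sub (hu.continuous.mul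
      ((hN.contMDiff.continuous.inner continuous_const).mul
        (continuous_euclideanMeanCurvature hN hX)))
  obtain ⟨ρ, hρ⟩ := SmoothPartitionOfUnity.exists_isSubordinate (𝓡 2) isClosed_univ
    (fun q : S => (extChartAt (𝓡 2) q).source) (fun q => isOpen_extChartAt_source q)
    (fun q _ => mem_iUnion.2 ⟨q, mem_extChartAt_source q⟩)
  have hfin : {q | (Function.support (ρ q)).Nonempty}.Finite :=
    ρ.locallyFinite.finite_nonempty_of_compact
  -- By compactness only finitely many members of the partition are not identically zero, so `u` is
  -- a finite sum of functions supported in chart domains.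
  have hsum : u = ∑ q ∈ hfin.toFinset, fun p => ρ q p * u p := by
    funext p
    rw [Finset.sum_apply, ← Finset.sum_mul]
    have h1 := ρ.sum_eq_one (mem_univ p)
    rw [finsum_eq_sum_of_support_subset (s := hfin.toFinset) _ (fun q hq => by
      exact hfin.mem_toFinset.2 ⟨p, hq⟩)] at h1
    rw [h1, one_mul]
  rw [hsum]
  refine (Finset.sum_induction (s := hfin.toFinset) (fun q p => ρ q p * u p)
    (fun u => ContMDiff (𝓡 2) 𝓘(ℝ, ℝ) ∞ u ∧
      ∫ p, (traceForm σ p (fun v w => mvfderiv (𝓡 2) u p v * mvfderiv (𝓡 2) η p w) -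
        u p * (inner ℝ (N p) a * euclideanMeanCurvature σ X N p)) ∂(volumeMeasure σ) = 0)
    ?_ ?_ ?_).2
  · rintro u₁ u₂ ⟨h1, i1⟩ ⟨h2, i2⟩
    refine ⟨h1.add h2, ?_⟩
    rw [← add_zero (0 : ℝ)]
    nth_rewrite 1 [← i1]
    rw [← i2, ← integral_add (integrable_of_continuous σ (hcont u₁ h1))
      (integrable_of_continuous σ (hcont u₂ h2))]
    -- Additivity in `u` is read off after writing the trace as `du(∇η)`.
    refine integral_congr_ae (Filter.Eventually.of_forall fun p => ?_)
    have hadd := mvfderiv_add (h1.mdifferentiableAt (x := p) (by norm_num))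
      (h2.mdifferentiableAt (x := p) (by norm_num))
    have e0 := traceForm_mul_mvfderiv σ η p (mvfderiv (𝓡 2) (u₁ + u₂) p).toLinearMap
    have e1 := traceForm_mul_mvfderiv σ η p (mvfderiv (𝓡 2) u₁ p).toLinearMap
    have e2 := traceForm_mul_mvfderiv σ η p (mvfderiv (𝓡 2) u₂ p).toLinearMap
    have e3 := DFunLike.congr_fun hadd (grad σ η p)
    have e4 := e0.trans (e3.trans (congrArg₂ (· + ·) e1.symm e2.symm))
    have e5 := congrArg (fun t => t - (u₁ + u₂) p * (inner ℝ (N p) a *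
      euclideanMeanCurvature σ X N p)) e4
    refine e5.trans ?_
    simp only [Pi.add_apply]
    exact (by intros; ring : ∀ s t x y z : ℝ, s + t - (x + y) * z = s - x * z + (t - y * z))
      _ _ _ _ _
  · refine ⟨contMDiff_const, ?_⟩
    refine integral_eq_zero_of_ae (Filter.Eventually.of_forall fun p => ?_)
    have e0 := traceForm_mul_mvfderiv σ η p (mvfderiv (𝓡 2) (0 : S → ℝ) p).toLinearMap
    have e1 := DFunLike.congr_fun (mvfderiv_zero (I := 𝓡 2) (F := ℝ) (x := p)) (grad σ η p)
    have e2 := congrArg (fun t => t - (0 : S → ℝ) p * (inner ℝ (N p) a *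
      euclideanMeanCurvature σ X N p)) (e0.trans e1)
    refine e2.trans ?_
    simp
  · intro q _
    have hs : ContMDiff (𝓡 2) 𝓘(ℝ, ℝ) ∞ fun p => ρ q p * u p := (ρ q).contMDiff.mul hu
    exact ⟨hs, integral_trace_linear_of_tsupport_subset hN hX hη hs
      ((tsupport_mul_subset_left).trans (hρ q)) (hcont _ hs)⟩

end Green

end BrownYork

/-! ### The inequality. -/

open BrownYork in
theorem proposition3p2
    -- the ambient three dimensional Riemannian manifold, possibly with boundary
    {H : Type*} [TopologicalSpace H]
    (I : ModelWithCorners ℝ (EuclideanSpace ℝ (Fin 3)) H)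
    {Ω : Type*} [TopologicalSpace Ω] [ChartedSpace H Ω] [IsManifold I ∞ Ω]
    (g : BrownYork.RMetric I Ω)
    -- the surface, diffeomorphic to the unit sphere, with its induced metric
    {S : Type*} [TopologicalSpace S] [ChartedSpace (EuclideanSpace ℝ (Fin 2)) S]
    [IsManifold (𝓡 2) ∞ S] [MeasurableSpace S] [BorelSpace S]
    (hS : Nonempty (S ≃ₘ^∞⟮𝓡 2, 𝓡 2⟯ sphere (0 : EuclideanSpace ℝ (Fin 3)) 1))
    (σ : BrownYork.RMetric (𝓡 2) S)
    (f : S → Ω) (hf : BrownYork.IsIsometricEmbedding σ g f)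
    (hK : ∀ p, 0 < BrownYork.gaussCurvature σ p)
    -- the unit normal in the ambient manifold, with respect to which the mean curvature is positive
    (ν : (p : S) → TangentSpace I (f p)) (hν : BrownYork.IsUnitNormal g f ν)
    (hH : ∀ p, 0 < BrownYork.meanCurvature σ g f ν p)
    -- the isometric embedding into Euclidean space and its outward unit normal
    (X : S → EuclideanSpace ℝ (Fin 3))
    (hX : BrownYork.IsEuclideanIsometricEmbedding σ X)
    (N : S → EuclideanSpace ℝ (Fin 3)) (hN : BrownYork.IsOutwardUnitNormal X N)
    (a₀ : ℝ) (a : EuclideanSpace ℝ (Fin 3)) (ha : ‖a‖ = 1)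
    (η : S → ℝ) (hη : ∀ p, η p = a₀ + ∑ i, a i * X p i) :
    8 * Real.pi * BrownYork.brownYorkMass σ
        (BrownYork.euclideanMeanCurvature σ X N) (BrownYork.meanCurvature σ g f ν) ≤
      ∫ p, ((BrownYork.laplacian σ η p) ^ 2 / BrownYork.meanCurvature σ g f ν p
          + (BrownYork.euclideanMeanCurvature σ X N p
              - BrownYork.meanCurvature σ g f ν p)
            * σ.inner p (BrownYork.grad σ η p) (BrownYork.grad σ η p)
          - BrownYork.euclideanSecondForm X N p
              (BrownYork.grad σ η p) (BrownYork.grad σ η p))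
        ∂(BrownYork.volumeMeasure σ) := by
  obtain ⟨φ⟩ := hS
  have : CompactSpace S := φ.toHomeomorph.symm.compactSpace
  have : T2Space S := φ.toHomeomorph.symm.t2Space
  have hη' : ∀ p, η p = a₀ + inner ℝ a (X p) := fun p => by
    rw [hη, PiLp.inner_apply]
    exact congrArg (a₀ + ·) (Finset.sum_congr rfl fun i _ => by simp [mul_comm])
  have hw : ContMDiff (𝓡 2) 𝓘(ℝ, ℝ) ∞ fun p => (inner ℝ a (N p) : ℝ) :=
    contMDiff_linear (a₀ := 0) hN.contMDiff fun p => (zero_add _).symm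
  have hGreen := integral_trace_linear hN hX hη' hw
  have cH := continuous_meanCurvature σ g hf.contMDiff hν
  have cH₀ := continuous_euclideanMeanCurvature hN hX
  have cw : Continuous fun p => (inner ℝ (N p) a : ℝ) :=
    hN.contMDiff.continuous.inner continuous_const
  have ctr := continuous_traceForm_mul σ hw (contMDiff_linear hX.contMDiff hη')
  have hmass : 8 * Real.pi * brownYorkMass σ (euclideanMeanCurvature σ X N)
      (meanCurvature σ g f ν) = ∫ p, (euclideanMeanCurvature σ X N p - meanCurvature σ g f ν p)
        ∂(volumeMeasure σ) := by
    unfold brownYorkMass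
    field_simp
  have i1 : Integrable (fun p => euclideanMeanCurvature σ X N p - meanCurvature σ g f ν p)
      (volumeMeasure σ) := integrable_of_continuous σ (cH₀.sub cH)
  have i2 := integrable_of_continuous σ (ctr.sub (hw.continuous.mul (cw.mul cH₀)))
  -- Subtracting the vanishing integral `hGreen` from the mass makes the trace terms cancel
  -- pointwise, so it remains to compare integrands.
  have hsplit := integral_sub i1 i2
  refine le_of_eq_of_le (hmass.trans (hsplit.trans
    ((congrArg (_ - ·) hGreen).trans (sub_zero _))).symm) ?_
  simp only [laplacian_linear hN hX hη', inner_grad_linear hN hX ha hη',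
    secondForm_grad_linear hN hX hη']
  refine integral_mono (i1.sub i2) (integrable_of_continuous σ
    (((((cw.mul cH₀).neg.pow 2).div₀ cH fun p => (hH p).ne').add
      ((cH₀.sub cH).mul (continuous_const.sub (cw.pow 2)))).sub ctr)) fun p => ?_
  -- The difference of the two integrands is exactly `((H₀ - H) ⟨N, a⟩)² / H`.
  have hpos : 0 ≤ ((euclideanMeanCurvature σ X N p - meanCurvature σ g f ν p) *
      inner ℝ (N p) a) ^ 2 / meanCurvature σ g f ν p := div_nonneg (sq_nonneg _) (hH p).le
  have hexp : ((euclideanMeanCurvature σ X N p - meanCurvature σ g f ν p) *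
      inner ℝ (N p) a) ^ 2 / meanCurvature σ g f ν p =
      (-(inner ℝ (N p) a * euclideanMeanCurvature σ X N p)) ^ 2 / meanCurvature σ g f ν p
        - 2 * euclideanMeanCurvature σ X N p * inner ℝ (N p) a ^ 2
        + meanCurvature σ g f ν p * inner ℝ (N p) a ^ 2 := by
    have := (hH p).ne'
    field_simp
    ring
  simp only [Pi.sub_apply, Pi.mul_apply, real_inner_comm (N p) a]
  rw [hexp] at hpos
  linarith
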